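/- Let $\gamma=(1+\sqrt5)/2$. For $\xi\in\mathbb{R}$ and $\mathbf{x}=(x_0,x_1,x_2)\in\mathbb{Z}^3$ put $\|\mathbf{x}\|=\max_i|x_i|$ and $L(\mathbf{x})=\max_{0\le i\le 2}|x_i-x_0\xi^i|$. A real number $\lambda$ is called an exponent of approximation to $\xi$ (in degree $2$) if there is a constant $c>0$ such that for every real $X\ge 1$ there is a non-zero $\mathbf{x}\in\mathbb{Z}^3$ with $\|\mathbf{x}\|\le X$ and $L(\mathbf{x})\le cX^{-\lambda}$. Identify $\mathbf{x}\in\mathbb{Z}^3$ with the symmetric matrix $\begin{pmatrix}x_0&x_1\\x_1&x_2\end{pmatrix}$, so that $\det(\mathbf{x})=x_0x_2-x_1^2$, write $\det(\mathbf{x},\mathbf{y},\mathbf{z})$ for the $3\times3$ determinant with rows $\mathbf{x},\mathbf{y},\mathbf{z}$, and put $[\mathbf{x},\mathbf{y},\mathbf{z}]=-\mathbf{x}J\mathbf{z}J\mathbf{y}$ with $J=\begin{pmatrix}0&1\\-1&0\end{pmatrix}$. For $1/2<\lambda\le 1/\gamma$ let $\theta=\lambda/(1-\lambda)$. An approximation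 sequence for $(\xi,\lambda)$ is an unbounded sequence $(\mathbf{y}_k)_{k\ge1}$ of primitive points of $\mathbb{Z}^3$ such that, with $Y_k=\|\mathbf{y}_k\|$ and implied constants independent of $k$, for all $k\ge1$, $$Y_k^{\theta}\ll Y_{k+1}\ll Y_k^{1/(\theta-1)},\qquad Y_k^{-1}\ll L(\mathbf{y}_k)\ll Y_k^{-\theta^2/(\theta+1)},$$ $$1\le|\det(\mathbf{y}_k)|\ll Y_k^{1-\theta^2/(\theta+1)},\qquad 1\le|\det(\mathbf{y}_k,\mathbf{y}_{k+1},\mathbf{y}_{k+2})|\ll Y_k^{1/(\theta-1)^2-\theta^2}.$$ There exists a number $\lambda_{\infty,2}=0.61455261\ldots$ with the following property. Let $\xi\in\mathbb{R}$ with $[\mathbb{Q}(\xi):\mathbb{Q}]>2$ and let $\lambda\in(\lambda_{\infty,2},1/\gamma]$ be an exponent of approximation to $\xi$. Then there exists an approximation sequence for $(\xi,\lambda)$, and every approximation sequence $(\mathbf{y}_k)_{k\ge1}$ for $(\xi,\lambda)$ satisfies: 1. for each sufficiently large $k\ge3$, the point $\mathbf{y}_{k+1}$ is a non-zero rational multiple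 of $[\mathbf{y}_k,\mathbf{y}_k,\mathbf{y}_{k-2}]$; 2. there exists a non-symmetric matrix $M\in\mathrm{Mat}_{2\times2}(\mathbb{Z})$ with $\det(M)\ne0$ such that, for each sufficiently large $k\ge3$, the point $\mathbf{y}_{k+1}$ is a non-zero rational multiple of $\mathbf{y}_kM_k\mathbf{y}_{k-1}$, where $M_k=M$ if $k$ is even and $M_k={}^tM$ if $k$ is odd. -/

import Mathlib

noncomputable section

/-- `L_∞(x) = ‖x - x₀ (1, ξ, ξ²)‖_∞` for an integer point `x = (x₀, x₁, x₂)`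
(the norm on `Fin 3 → ℝ` is the maximum norm). -/
def LInf (ξ : ℝ) (x : Fin 3 → ℤ) : ℝ :=
  ‖fun i : Fin 3 => (x i : ℝ) - (x 0 : ℝ) * ξ ^ (i : ℕ)‖

/-- `lam` is an exponent of approximation to `ξ` in degree `2`
(the norm on `Fin 3 → ℤ` is the maximum norm). -/
def IsExponentOfApproximation (ξ lam : ℝ) : Prop :=
  ∃ c : ℝ, 0 < c ∧ ∀ X : ℝ, 1 ≤ X →
    ∃ x : Fin 3 → ℤ, x ≠ 0 ∧ ‖x‖ ≤ X ∧ LInf ξ x ≤ c * X ^ (-lam)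

/-- An integer point whose coordinates have no common divisor other than `±1`. -/
def IsPrimitivePoint (x : Fin 3 → ℤ) : Prop :=
  ∀ d : ℤ, (∀ i, d ∣ x i) → IsUnit d

/-- The symmetric matrix attached to an integer point. -/
def symMat (x : Fin 3 → ℤ) : Matrix (Fin 2) (Fin 2) ℤ :=
  !![x 0, x 1; x 1, x 2]

/-- The matrix `J`. -/
def matJ : Matrix (Fin 2) (Fin 2) ℤ :=
  !![0, 1; -1, 0]

/-- `[x, y, z] = -x J z J y`, points being viewed as symmetric matrices. -/
def bracket (x y z : Fin 3 → ℤ) : Matrix (Fin 2) (Fin 2) ℤ :=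
  -(symMat x * matJ * symMat z * matJ * symMat y)

/-- `A = r B` for some non-zero rational number `r`. -/
def IsNonzeroRationalMultiple (A B : Matrix (Fin 2) (Fin 2) ℤ) : Prop :=
  ∃ r : ℚ, r ≠ 0 ∧ A.map (Int.cast : ℤ → ℚ) = r • B.map (Int.cast : ℤ → ℚ)

/-- `u_k ≪ v_k` for sequences indexed by `k ≥ 1`: the implied constant is independent of `k`. -/
def Dominated (u v : ℕ → ℝ) : Prop :=
  ∃ c : ℝ, 0 < c ∧ ∀ k : ℕ, 1 ≤ k → u k ≤ c * v k

/-- The exponent `θ(λ) = λ / (1 - λ)`. -/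
def thetaOf (lam : ℝ) : ℝ := lam / (1 - lam)

/-- An unbounded sequence `(y_k)_{k ≥ 1}` of primitive integer points attached to `ξ` and to
the exponent `lam`, with the growth conditions on the norms `Y_k = ‖y_k‖_∞`, on `L_∞(y_k)`, and
on the determinants of the points and of triples of consecutive points. The term `y 0` plays
no role. -/
structure IsApproximationSequence (ξ lam : ℝ) (y : ℕ → Fin 3 → ℤ) : Prop where
  primitive : ∀ k : ℕ, 1 ≤ k → IsPrimitivePoint (y k)
  unbounded : ∀ B : ℝ, ∃ k : ℕ, 1 ≤ k ∧ B < ‖y k‖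
  norm_lower : Dominated (fun k => ‖y k‖ ^ thetaOf lam) (fun k => ‖y (k + 1)‖)
  norm_upper : Dominated (fun k => ‖y (k + 1)‖) (fun k => ‖y k‖ ^ (1 / (thetaOf lam - 1)))
  LInf_lower : Dominated (fun k => ‖y k‖ ^ (-1 : ℝ)) (fun k => LInf ξ (y k))
  LInf_upper : Dominated (fun k => LInf ξ (y k))
    (fun k => ‖y k‖ ^ (-(thetaOf lam ^ 2 / (thetaOf lam + 1))))
  det_lower : ∀ k : ℕ, 1 ≤ k → 1 ≤ |(symMat (y k)).det|
  det_upper : Dominated (fun k => ((|(symMat (y k)).det| : ℤ) : ℝ))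
    (fun k => ‖y k‖ ^ (1 - thetaOf lam ^ 2 / (thetaOf lam + 1)))
  det₃_lower : ∀ k : ℕ, 1 ≤ k → 1 ≤ |(Matrix.of ![y k, y (k + 1), y (k + 2)]).det|
  det₃_upper : Dominated
    (fun k => ((|(Matrix.of ![y k, y (k + 1), y (k + 2)]).det| : ℤ) : ℝ))
    (fun k => ‖y k‖ ^ (1 / (thetaOf lam - 1) ^ 2 - thetaOf lam ^ 2))

/-- `M_k = M` for even `k` and `M_k = ᵗM` for odd `k`. -/
def alternating (M : Matrix (Fin 2) (Fin 2) ℤ) (k : ℕ) : Matrix (Fin 2) (Fin 2) ℤ :=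
  if Even k then M else M.transpose

end

open Matrix Filter Topology

noncomputable section

/-! Write Y_k = ‖y_k‖. The map z ↦ [x, x, z] is an involution up to the factor det(x)², so the first
assertion amounts to w = [y_{k+3}, y_{k+3}, y_{k+4}] being proportional to y_{k+1}. The growth
conditions give ‖w‖ ≪ Y_{k+3}^{0.44} and L(w) ≪ Y_{k+3}^{-0.275}. This is enough to make the
integers det(w, y_k, y_{k+1}) and det(w, y_{k+1}, y_{k+2}) less than 1 in absolute value for large
k, hence zero. So w lies in two planes, which meet in the line of y_{k+1} because y_k, y_{k+1},
y_{k+2} are independent (`eventually_bracketPoint`).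

The second assertion follows by algebra (`exists_alternating_of_bracket`): M is found by solving for
it at one index, and the identity JzJz = -det(z) shows that the recurrence of the first assertion
replaces M by its transpose at each step. A symmetric M would yield a fixed non-zero vector
proportional to all y_k, against their independence.

Existence (`exists_isApproximationSequence`) needs only 1/2 < λ < 1. Among the minimal points of ξ
one keeps those at which the plane spanned by consecutive points changes; the growth conditions come
from the fact that non-zero integer determinants are at least 1. -/

/-! ### Size estimates for points and determinants. -/

lemma abs_apply_le_norm (x : Fin 3 → ℤ) (i : Fin 3) : |(x i : ℝ)| ≤ ‖x‖ := by
  simpa [Int.norm_eq_abs] using norm_le_pi_norm x i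

lemma norm_le_of_abs_apply_le {x : Fin 3 → ℤ} {B : ℝ} (h : ∀ i, |(x i : ℝ)| ≤ B) : ‖x‖ ≤ B := by
  refine (pi_norm_le_iff_of_nonneg ((abs_nonneg _).trans (h 0))).2 fun i => ?_
  simpa [Int.norm_eq_abs] using h i

lemma one_le_norm {x : Fin 3 → ℤ} (hx : x ≠ 0) : 1 ≤ ‖x‖ := by
  obtain ⟨i, hi⟩ := Function.ne_iff.1 hx
  refine le_trans ?_ (abs_apply_le_norm x i)
  exact_mod_cast Int.one_le_abs hi

lemma LInf_nonneg (ξ : ℝ) (x : Fin 3 → ℤ) : 0 ≤ LInf ξ x := norm_nonneg _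

lemma abs_sub_le_LInf (ξ : ℝ) (x : Fin 3 → ℤ) (i : Fin 3) :
    |(x i : ℝ) - x 0 * ξ ^ (i : ℕ)| ≤ LInf ξ x :=
  norm_le_pi_norm (fun i : Fin 3 => (x i : ℝ) - (x 0 : ℝ) * ξ ^ (i : ℕ)) i

lemma LInf_le_of {ξ : ℝ} {x : Fin 3 → ℤ} {B : ℝ} (h1 : |(x 1 : ℝ) - x 0 * ξ| ≤ B)
    (h2 : |(x 2 : ℝ) - x 0 * ξ ^ 2| ≤ B) : LInf ξ x ≤ B := by
  refine (pi_norm_le_iff_of_nonneg ((abs_nonneg _).trans h1)).2 fun i => ?_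
  fin_cases i
  · simpa using (abs_nonneg _).trans h1
  · simpa using h1
  · simpa using h2

/-- A point written as a multiple of `(1, ξ, ξ²)` plus a small deviation. -/
lemma exists_deviation (ξ : ℝ) (x : Fin 3 → ℤ) : ∃ a b : ℝ, |a| ≤ LInf ξ x ∧ |b| ≤ LInf ξ x ∧
    (x 1 : ℝ) = x 0 * ξ + a ∧ (x 2 : ℝ) = x 0 * ξ ^ 2 + b := by
  refine ⟨x 1 - x 0 * ξ, x 2 - x 0 * ξ ^ 2, ?_, ?_, by ring, by ring⟩
  · simpa using abs_sub_le_LInf ξ x 1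
  · simpa using abs_sub_le_LInf ξ x 2

/-- A constant bounding `1`, `|ξ|` and `ξ²`. -/
def powBound (ξ : ℝ) : ℝ := 1 + |ξ| + ξ ^ 2

lemma one_le_powBound (ξ : ℝ) : 1 ≤ powBound ξ := by 
  unfold powBound; nlinarith [abs_nonneg ξ, sq_nonneg ξ]
lemma abs_le_powBound (ξ : ℝ) : |ξ| ≤ powBound ξ := by
  unfold powBound; nlinarith [sq_nonneg ξ]
lemma sq_le_powBound (ξ : ℝ) : ξ ^ 2 ≤ powBound ξ := by
  unfold powBound; nlinarith [abs_nonneg ξ]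

lemma abs_mul_le_mul' {a b A B : ℝ} (ha : |a| ≤ A) (hb : |b| ≤ B) : |a * b| ≤ A * B := by
  rw [abs_mul]
  exact mul_le_mul ha hb (abs_nonneg _) ((abs_nonneg _).trans ha)

lemma abs_add_le_add {a b A B : ℝ} (ha : |a| ≤ A) (hb : |b| ≤ B) : |a + b| ≤ A + B :=
  (abs_add_le a b).trans (add_le_add ha hb)

lemma abs_sub_le_add {a b A B : ℝ} (ha : |a| ≤ A) (hb : |b| ≤ B) : |a - b| ≤ A + B :=
  (abs_sub a b).trans (add_le_add ha hb)

lemma powBound_pos (ξ : ℝ) : 0 < powBound ξ := zero_lt_one.trans_le (one_le_powBound ξ)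

lemma norm_le_powBound_mul (ξ : ℝ) (x : Fin 3 → ℤ) :
    ‖x‖ ≤ powBound ξ * |(x 0 : ℝ)| + LInf ξ x := by
  obtain ⟨a, b, ha, hb, h1, h2⟩ := exists_deviation ξ x
  have hL := LInf_nonneg ξ x
  refine norm_le_of_abs_apply_le fun i => ?_
  fin_cases i
  · show |(x 0 : ℝ)| ≤ _
    nlinarith [one_le_powBound ξ, abs_nonneg (x 0 : ℝ)]
  · show |(x 1 : ℝ)| ≤ _
    rw [h1, mul_comm (powBound ξ)]
    exact abs_add_le_add (abs_mul_le_mul' le_rfl (abs_le_powBound ξ)) ha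
  · show |(x 2 : ℝ)| ≤ _
    rw [h2, mul_comm (powBound ξ)]
    refine abs_add_le_add (abs_mul_le_mul' le_rfl ?_) hb
    rw [abs_of_nonneg (sq_nonneg ξ)]
    exact sq_le_powBound ξ

lemma LInf_le_norm (ξ : ℝ) (x : Fin 3 → ℤ) : LInf ξ x ≤ 2 * powBound ξ * ‖x‖ := by
  have hK := one_le_powBound ξ
  have h : 1 * ‖x‖ + ‖x‖ * powBound ξ ≤ 2 * powBound ξ * ‖x‖ := by
    nlinarith [norm_nonneg x]
  refine LInf_le_of (le_trans ?_ h) (le_trans ?_ h)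
  · refine abs_sub_le_add ?_ (abs_mul_le_mul' (abs_apply_le_norm x 0) (abs_le_powBound ξ))
    simpa using abs_apply_le_norm x 1
  · refine abs_sub_le_add ?_ (abs_mul_le_mul' (abs_apply_le_norm x 0) ?_)
    · simpa using abs_apply_le_norm x 2
    · rw [abs_of_nonneg (sq_nonneg ξ)]
      exact sq_le_powBound ξ

lemma det_symMat (x : Fin 3 → ℤ) : (symMat x).det = x 0 * x 2 - x 1 ^ 2 := by
  simp [symMat, Matrix.det_fin_two]; ring

lemma abs_det_symMat_le (ξ : ℝ) (x : Fin 3 → ℤ) :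
    ((|(symMat x).det| : ℤ) : ℝ) ≤ 5 * powBound ξ * (‖x‖ * LInf ξ x) := by
  obtain ⟨a, b, ha, hb, h1, h2⟩ := exists_deviation ξ x
  have hL := LInf_nonneg ξ x
  have hK := one_le_powBound ξ
  have e : (((symMat x).det : ℤ) : ℝ) = x 0 * b - (ξ * (x 0 * a) + ξ * (x 0 * a)) - a * a := by
    rw [det_symMat]; push_cast; rw [h1, h2]; ring
  rw [Int.cast_abs, e]
  have h0 := abs_apply_le_norm x 0
  have h3 := abs_mul_le_mul' (abs_le_powBound ξ) (abs_mul_le_mul' h0 ha)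
  refine (abs_sub_le_add (abs_sub_le_add (abs_mul_le_mul' h0 hb) (abs_add_le_add h3 h3))
    (abs_mul_le_mul' ha (ha.trans (LInf_le_norm ξ x)))).trans ?_
  have : 0 ≤ ‖x‖ * LInf ξ x := by positivity
  nlinarith

lemma abs_det₃_le (ξ : ℝ) (x y z : Fin 3 → ℤ) :
    ((|(Matrix.of ![x, y, z]).det| : ℤ) : ℝ) ≤
      2 * (‖x‖ * LInf ξ y * LInf ξ z + ‖y‖ * LInf ξ x * LInf ξ z +
        ‖z‖ * LInf ξ x * LInf ξ y) := by
  obtain ⟨a, b, ha, hb, h1, h2⟩ := exists_deviation ξ x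
  obtain ⟨c, d, hc, hd, h3, h4⟩ := exists_deviation ξ y
  obtain ⟨e, f, he, hf, h5, h6⟩ := exists_deviation ξ z
  have E : (((Matrix.of ![x, y, z]).det : ℤ) : ℝ) =
      (x 0 * c * f - x 0 * d * e) - (y 0 * a * f - y 0 * b * e) + (z 0 * a * d - z 0 * b * c) := by
    rw [Matrix.det_fin_three]
    simp only [Matrix.of_apply, Matrix.cons_val]
    push_cast
    rw [h1, h2, h3, h4, h5, h6]; ring
  rw [Int.cast_abs, E]
  have hx := abs_apply_le_norm x 0
  have hy := abs_apply_le_norm y 0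
  have hz := abs_apply_le_norm z 0
  have key {u v w A B C : ℝ} (h₁ : |u| ≤ A) (h₂ : |v| ≤ B) (h₃ : |w| ≤ C) :=
    abs_mul_le_mul' (abs_mul_le_mul' h₁ h₂) h₃
  refine (abs_add_le_add (abs_sub_le_add
    (abs_sub_le_add (key hx hc hf) (key hx hd he))
    (abs_sub_le_add (key hy ha hf) (key hy hb he)))
    (abs_sub_le_add (key hz ha hd) (key hz hb hc))).trans ?_
  linarith

/-- A `2 × 2` determinant of two pairs with slopes close to `ξ`. -/
lemma abs_minor_le {ξ u v s t X Y L M : ℝ} (hu : |u| ≤ X) (hs : |s| ≤ Y)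
    (hv : |v - u * ξ| ≤ L) (ht : |t - s * ξ| ≤ M) : |u * t - v * s| ≤ X * M + L * Y := by
  rw [show u * t - v * s = u * (t - s * ξ) - (v - u * ξ) * s by ring]
  exact abs_sub_le_add (abs_mul_le_mul' hu ht) (abs_mul_le_mul' hv hs)

lemma abs_apply_two_sub_le (ξ : ℝ) (x : Fin 3 → ℤ) :
    |(x 2 : ℝ) - x 1 * ξ| ≤ 2 * powBound ξ * LInf ξ x := by
  obtain ⟨a, b, ha, hb, h1, h2⟩ := exists_deviation ξ x
  rw [h1, h2, show (x 0 * ξ ^ 2 + b - (x 0 * ξ + a) * ξ : ℝ) = b - a * ξ by ring]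
  refine (abs_sub_le_add hb (abs_mul_le_mul' ha (abs_le_powBound ξ))).trans ?_
  nlinarith [one_le_powBound ξ, LInf_nonneg ξ x]

lemma abs_apply_one_sub_le (ξ : ℝ) (x : Fin 3 → ℤ) :
    |(x 1 : ℝ) - x 0 * ξ| ≤ LInf ξ x := by
  simpa using abs_sub_le_LInf ξ x 1

lemma abs_apply_one_sub_le' (ξ : ℝ) (x : Fin 3 → ℤ) :
    |(x 1 : ℝ) - x 0 * ξ| ≤ 2 * powBound ξ * LInf ξ x := by
  nlinarith [abs_apply_one_sub_le ξ x, one_le_powBound ξ, LInf_nonneg ξ x]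

/-- All entries of `x J y` are `≪ ‖x‖ L(y) + ‖y‖ L(x)`. -/
lemma abs_symMat_mul_J_mul_le (ξ : ℝ) (x y : Fin 3 → ℤ) {i j k l : Fin 3}
    (h : (i = 0 ∧ j = 1) ∨ (i = 1 ∧ j = 2)) (h' : (k = 0 ∧ l = 1) ∨ (k = 1 ∧ l = 2)) :
    |(x i : ℝ) * y l - x j * y k| ≤ 2 * powBound ξ * (‖x‖ * LInf ξ y + ‖y‖ * LInf ξ x) := by
  have hx : |(x j : ℝ) - x i * ξ| ≤ 2 * powBound ξ * LInf ξ x := by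
    rcases h with ⟨rfl, rfl⟩ | ⟨rfl, rfl⟩
    exacts [abs_apply_one_sub_le' ξ x, abs_apply_two_sub_le ξ x]
  have hy : |(y l : ℝ) - y k * ξ| ≤ 2 * powBound ξ * LInf ξ y := by
    rcases h' with ⟨rfl, rfl⟩ | ⟨rfl, rfl⟩
    exacts [abs_apply_one_sub_le' ξ y, abs_apply_two_sub_le ξ y]
  refine (abs_minor_le (abs_apply_le_norm x i) (abs_apply_le_norm y k) hx hy).trans (le_of_eq ?_)
  ring

/-! ### The point [x, x, y] and its size. -/

/-- The point attached to the symmetric matrix `[x, x, y]`. -/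
def bracketPoint (x y : Fin 3 → ℤ) : Fin 3 → ℤ :=
  ![(x 0 * y 2 - x 1 * y 1) * x 0 - (x 0 * y 1 - x 1 * y 0) * x 1,
    (x 0 * y 2 - x 1 * y 1) * x 1 - (x 0 * y 1 - x 1 * y 0) * x 2,
    (x 1 * y 2 - x 2 * y 1) * x 1 - (x 1 * y 1 - x 2 * y 0) * x 2]

lemma symMat_bracketPoint (x y : Fin 3 → ℤ) : symMat (bracketPoint x y) = bracket x x y := by
  ext i j
  fin_cases i <;> fin_cases j <;>
    simp [symMat, bracketPoint, bracket, matJ] <;> ring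

/-- In [x, x, y] = -(xJy)(Jx), the entries of xJy are already small, and applying Jx to the
direction of ξ leaves only the deviations x₁ - x₀ξ and x₂ - x₁ξ. -/
lemma LInf_bracketPoint_le (ξ : ℝ) (x y : Fin 3 → ℤ) : LInf ξ (bracketPoint x y) ≤
    24 * powBound ξ ^ 3 * ((‖x‖ * LInf ξ y + ‖y‖ * LInf ξ x) * LInf ξ x) := by
  have hp := abs_symMat_mul_J_mul_le ξ x y (.inl ⟨rfl, rfl⟩) (.inl ⟨rfl, rfl⟩)
  have hq := abs_symMat_mul_J_mul_le ξ x y (.inl ⟨rfl, rfl⟩) (.inr ⟨rfl, rfl⟩)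
  have hr := abs_symMat_mul_J_mul_le ξ x y (.inr ⟨rfl, rfl⟩) (.inl ⟨rfl, rfl⟩)
  have hs := abs_symMat_mul_J_mul_le ξ x y (.inr ⟨rfl, rfl⟩) (.inr ⟨rfl, rfl⟩)
  have h1 := abs_apply_one_sub_le' ξ x
  have h2 := abs_apply_two_sub_le ξ x
  have hK := one_le_powBound ξ
  have hB : 0 ≤ (‖x‖ * LInf ξ y + ‖y‖ * LInf ξ x) * LInf ξ x := by
    have := LInf_nonneg ξ x
    have := LInf_nonneg ξ y
    positivity
  set B := ‖x‖ * LInf ξ y + ‖y‖ * LInf ξ x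
  have e1 := abs_sub_le_add (abs_mul_le_mul' hq h1) (abs_mul_le_mul' hp h2)
  have e2 := abs_sub_le_add (abs_mul_le_mul' hs h1) (abs_mul_le_mul' hr h2)
  have K2 : powBound ξ ^ 2 ≤ powBound ξ ^ 3 := pow_le_pow_right₀ hK (by norm_num)
  have hK2 := mul_le_mul_of_nonneg_right K2 hB
  have hK3 : 0 ≤ powBound ξ ^ 3 * (B * LInf ξ x) := by positivity
  refine LInf_le_of ?_ ?_
  · rw [show ((bracketPoint x y 1 : ℤ) : ℝ) - (bracketPoint x y 0 : ℤ) * ξ =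
      ((x 0 * y 2 - x 1 * y 1) * (x 1 - x 0 * ξ) - (x 0 * y 1 - x 1 * y 0) * (x 2 - x 1 * ξ) : ℝ) by
        simp [bracketPoint]; ring]
    refine e1.trans ?_
    linarith
  · rw [show ((bracketPoint x y 2 : ℤ) : ℝ) - (bracketPoint x y 0 : ℤ) * ξ ^ 2 =
      ((x 1 * y 2 - x 2 * y 1) * (x 1 - x 0 * ξ) - (x 1 * y 1 - x 2 * y 0) * (x 2 - x 1 * ξ)) + ξ *
      ((x 0 * y 2 - x 1 * y 1) * (x 1 - x 0 * ξ) - (x 0 * y 1 - x 1 * y 0) * (x 2 - x 1 * ξ) : ℝ) by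
        simp [bracketPoint]; ring]
    refine (abs_add_le_add e2 (abs_mul_le_mul' (abs_le_powBound ξ) e1)).trans ?_
    linarith

/-- Expanded in the deviations of x and y, the first coordinate loses its terms in x₀²y₀ and in
x₀y₀. The surviving mixed term ‖x‖L(x)L(y) is absorbed by L(x) ≪ ‖x‖. -/
lemma norm_bracketPoint_le (ξ : ℝ) (x y : Fin 3 → ℤ) : ‖bracketPoint x y‖ ≤
    100 * powBound ξ ^ 4 * (‖x‖ ^ 2 * LInf ξ y + ‖y‖ * LInf ξ x ^ 2) := by
  have hw := LInf_bracketPoint_le ξ x y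
  have hn := norm_le_powBound_mul ξ (bracketPoint x y)
  obtain ⟨a, b, ha, hb, h1, h2⟩ := exists_deviation ξ x
  obtain ⟨c, d, hc, hd, h3, h4⟩ := exists_deviation ξ y
  have hx := abs_apply_le_norm x 0
  have hy := abs_apply_le_norm y 0
  have hK := one_le_powBound ξ
  have hL := LInf_le_norm ξ x
  have hL0 := LInf_nonneg ξ x
  have hM0 := LInf_nonneg ξ y
  have e0 : ((bracketPoint x y 0 : ℤ) : ℝ) = (x 0 * x 0 * d - (x 0 * x 0 * c * ξ + x 0 * x 0 * c * ξ))
      - (a * c * x 0 + a * c * x 0) + a * a * y 0 := by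
    simp [bracketPoint]
    rw [h1, h3, h4]; ring
  have h0 := abs_add_le_add (abs_sub_le_add (abs_sub_le_add
      (abs_mul_le_mul' (abs_mul_le_mul' hx hx) hd)
      (abs_add_le_add (abs_mul_le_mul' (abs_mul_le_mul' (abs_mul_le_mul' hx hx) hc) (abs_le_powBound ξ))
        (abs_mul_le_mul' (abs_mul_le_mul' (abs_mul_le_mul' hx hx) hc) (abs_le_powBound ξ))))
      (abs_add_le_add (abs_mul_le_mul' (abs_mul_le_mul' ha hc) hx)
        (abs_mul_le_mul' (abs_mul_le_mul' ha hc) hx)))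
      (abs_mul_le_mul' (abs_mul_le_mul' ha ha) hy)
  rw [← e0] at h0
  set K := powBound ξ
  set X := ‖x‖
  set Y := ‖y‖
  set L := LInf ξ x
  set M := LInf ξ y
  have hX : 0 ≤ X := norm_nonneg x
  have hY : 0 ≤ Y := norm_nonneg y
  have hKL : L * M * X ≤ 2 * K * (X ^ 2 * M) := by
    have : L * (M * X) ≤ 2 * K * X * (M * X) := mul_le_mul_of_nonneg_right hL (by positivity)
    linarith
  set U := X ^ 2 * M with hU
  set V := Y * L ^ 2 with hV
  have hU0 : 0 ≤ U := by positivity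
  have hV0 : 0 ≤ V := by positivity
  have h0' : |((bracketPoint x y 0 : ℤ) : ℝ)| ≤ 7 * K * U + V := by
    have e : X * X * M + (X * X * M * K + X * X * M * K) + (L * M * X + L * M * X) + L * L * Y
       = U + 2 * (K * U) + 2 * (L * M * X) + V := by rw [hU, hV]; ring
    have : U ≤ K * U := by nlinarith
    linarith
  have hw' : LInf ξ (bracketPoint x y) ≤ 48 * K ^ 4 * U + 24 * K ^ 3 * V := by
    have e : (X * M + Y * L) * L = L * M * X + V := by rw [hV]; ring
    rw [e] at hw
    have := mul_le_mul_of_nonneg_left hKL (show 0 ≤ 24 * K ^ 3 by positivity)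
    linarith
  have hb0 := mul_le_mul_of_nonneg_left h0' (show 0 ≤ K by positivity)
  have k2 : K ^ 2 * U ≤ K ^ 4 * U :=
    mul_le_mul_of_nonneg_right (pow_le_pow_right₀ hK (by norm_num)) hU0
  have k3 : K ^ 3 * V ≤ K ^ 4 * V :=
    mul_le_mul_of_nonneg_right (pow_le_pow_right₀ hK (by norm_num)) hV0
  have k1 : K ^ 1 * V ≤ K ^ 4 * V :=
    mul_le_mul_of_nonneg_right (pow_le_pow_right₀ hK (by norm_num)) hV0
  have p1 : 0 ≤ K ^ 4 * U := by positivity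
  have p2 : 0 ≤ K ^ 4 * V := by positivity
  linarith

/-! ### Cross products and proportionality. -/

lemma norm_crossProduct_le (ξ : ℝ) (x y : Fin 3 → ℤ) :
    ‖x ⨯₃ y‖ ≤ 4 * powBound ξ * (‖x‖ * LInf ξ y + ‖y‖ * LInf ξ x) := by
  have hK := one_le_powBound ξ
  have hB : 0 ≤ ‖x‖ * LInf ξ y + ‖y‖ * LInf ξ x := by
    have := LInf_nonneg ξ x
    have := LInf_nonneg ξ y
    positivity
  have h01 := abs_symMat_mul_J_mul_le ξ x y (.inl ⟨rfl, rfl⟩) (.inl ⟨rfl, rfl⟩)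
  have h12 := abs_symMat_mul_J_mul_le ξ x y (.inr ⟨rfl, rfl⟩) (.inr ⟨rfl, rfl⟩)
  have h02 : |(x 0 : ℝ) * y 2 - x 2 * y 0| ≤ 2 * powBound ξ * (‖x‖ * LInf ξ y + ‖y‖ * LInf ξ x) := by
    refine (abs_minor_le (ξ := ξ ^ 2) (abs_apply_le_norm x 0) (abs_apply_le_norm y 0)
      (by simpa using abs_sub_le_LInf ξ x 2) (by simpa using abs_sub_le_LInf ξ y 2)).trans ?_
    nlinarith
  have h : 2 * powBound ξ * (‖x‖ * LInf ξ y + ‖y‖ * LInf ξ x) ≤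
    4 * powBound ξ * (‖x‖ * LInf ξ y + ‖y‖ * LInf ξ x) := by
      gcongr; norm_num
  refine norm_le_of_abs_apply_le fun i => le_trans ?_ h
  rw [cross_apply]
  fin_cases i
  · simpa using h12
  · rw [abs_sub_comm] at h02
    simpa using h02
  · simpa using h01

/-- The vector v × n is orthogonal to v, and by the two vanishing determinants also to u and w,
which together with v form a basis. -/
lemma crossProduct_eq_zero_of_det_eq_zero {u v w n : Fin 3 → ℤ}
    (h : (Matrix.of ![u, v, w]).det ≠ 0) (h₁ : (Matrix.of ![n, u, v]).det = 0)
    (h₂ : (Matrix.of ![n, v, w]).det = 0) : v ⨯₃ n = 0 := by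
  refine Matrix.eq_zero_of_mulVec_eq_zero h ?_
  rw [Matrix.det_fin_three] at h₁ h₂
  simp only [Matrix.of_apply, Matrix.cons_val] at h₁ h₂
  ext i
  fin_cases i
  · simp [Matrix.mulVec, dotProduct, Fin.sum_univ_three, cross_apply]; linarith
  · simp [Matrix.mulVec, dotProduct, Fin.sum_univ_three, cross_apply]; ring
  · simp [Matrix.mulVec, dotProduct, Fin.sum_univ_three, cross_apply]; linarith

lemma mul_apply_comm_of_crossProduct_eq_zero {x y : Fin 3 → ℤ} (h : x ⨯₃ y = 0) (i j : Fin 3) :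
    x i * y j = x j * y i := by
  rw [cross_apply] at h
  have h0 := congrFun h 0
  have h1 := congrFun h 1
  have h2 := congrFun h 2
  simp at h0 h1 h2
  fin_cases i <;> fin_cases j <;> simp <;> linarith

lemma exists_rat_mul_of_crossProduct_eq_zero {x y : Fin 3 → ℤ} (hx : x ≠ 0) (h : x ⨯₃ y = 0) :
    ∃ r : ℚ, ∀ i, (y i : ℚ) = r * x i := by
  obtain ⟨j, hj⟩ := Function.ne_iff.1 hx
  have hj' : (x j : ℚ) ≠ 0 := by exact_mod_cast hj
  refine ⟨y j / x j, fun i => ?_⟩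
  have := mul_apply_comm_of_crossProduct_eq_zero h i j
  have : (x i : ℚ) * y j = x j * y i := by exact_mod_cast this
  field_simp
  linarith

/-! ### Algebra of the bracket. -/

lemma det_symMat_bracketPoint (x y : Fin 3 → ℤ) :
    (symMat (bracketPoint x y)).det = (symMat x).det ^ 2 * (symMat y).det := by
  simp only [det_symMat, bracketPoint, Matrix.cons_val]; ring

/-- Both xJxJ and JxJx equal -det(x), so the outer factors collapse to scalars. -/
lemma bracketPoint_bracketPoint (x y : Fin 3 → ℤ) (i : Fin 3) :
    bracketPoint x (bracketPoint x y) i = (symMat x).det ^ 2 * y i := by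
  fin_cases i <;> simp [det_symMat, bracketPoint] <;> ring

lemma ne_zero_of_det_symMat_ne_zero {x : Fin 3 → ℤ} (h : (symMat x).det ≠ 0) : x ≠ 0 := by
  rintro rfl
  simp [det_symMat] at h

/-- If `[x, x, y]` is proportional to `z` then `y` is proportional to `[x, x, z]`. -/
lemma isNonzeroRationalMultiple_bracket {x y z : Fin 3 → ℤ} (hx : (symMat x).det ≠ 0)
    (hy : (symMat y).det ≠ 0) (hz : z ≠ 0) (h : z ⨯₃ bracketPoint x y = 0) :
    IsNonzeroRationalMultiple (symMat y) (bracket x x z) := by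
  obtain ⟨r, hr⟩ := exists_rat_mul_of_crossProduct_eq_zero hz h
  have hd : ((symMat x).det : ℚ) ≠ 0 := by exact_mod_cast hx
  -- The determinant of [x, x, y] is det(x)² det(y), so this point cannot vanish.
  have hr0 : r ≠ 0 := by
    rintro rfl
    have : bracketPoint x y = 0 := by
      ext i
      have := hr i
      rw [zero_mul] at this
      exact_mod_cast this
    have h2 := det_symMat_bracketPoint x y
    rw [this, det_symMat] at h2
    simp at h2
    tauto
  have key : ∀ i, (y i : ℚ) = r / ((symMat x).det : ℚ) ^ 2 * bracketPoint x z i := by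
    intro i
    have h1 : ((symMat x).det ^ 2 : ℚ) * y i = r * bracketPoint x z i := by
      rw [← Int.cast_pow, ← Int.cast_mul, ← bracketPoint_bracketPoint]
      generalize bracketPoint x y = w at hr
      fin_cases i <;> simp [bracketPoint, hr] <;> ring
    field_simp
    linarith
  refine ⟨r / ((symMat x).det : ℚ) ^ 2, by positivity, ?_⟩
  rw [← symMat_bracketPoint]
  ext i j
  fin_cases i <;> fin_cases j <;> simp [symMat, key]

/-! ### Proportional matrices and the construction of M. -/

namespace IsNonzeroRationalMultiple

variable {A B C : Matrix (Fin 2) (Fin 2) ℤ}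

lemma trans (h : IsNonzeroRationalMultiple A B) (h' : IsNonzeroRationalMultiple B C) :
    IsNonzeroRationalMultiple A C := by
  obtain ⟨r, hr, e⟩ := h
  obtain ⟨s, hs, e'⟩ := h'
  exact ⟨r * s, mul_ne_zero hr hs, by rw [e, e', smul_smul]⟩

lemma mul_left (h : IsNonzeroRationalMultiple A B) (C : Matrix (Fin 2) (Fin 2) ℤ) :
    IsNonzeroRationalMultiple (C * A) (C * B) := by
  obtain ⟨r, hr, e⟩ := h
  refine ⟨r, hr, ?_⟩
  have := Matrix.map_mul (L := C) (M := A) (f := Int.castRingHom ℚ)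
  have h2 := Matrix.map_mul (L := C) (M := B) (f := Int.castRingHom ℚ)
  simp only [Int.coe_castRingHom] at this h2
  rw [this, h2, e, Matrix.mul_smul]

lemma transpose (h : IsNonzeroRationalMultiple A B) :
    IsNonzeroRationalMultiple Aᵀ Bᵀ := by
  obtain ⟨r, hr, e⟩ := h
  refine ⟨r, hr, ?_⟩
  rw [Matrix.transpose_map, Matrix.transpose_map, e, Matrix.transpose_smul]

lemma of_smul_eq {d : ℤ} (hd : d ≠ 0) (h : d • A = B) : IsNonzeroRationalMultiple A B := by
  have hd' : (d : ℚ) ≠ 0 := by exact_mod_cast hd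
  refine ⟨(d : ℚ)⁻¹, inv_ne_zero hd', ?_⟩
  ext i j
  simp [← h, hd', -zsmul_eq_mul, -zsmul_one]

lemma smul_right {d : ℤ} (hd : d ≠ 0) : IsNonzeroRationalMultiple (d • A) A := by
  have hd' : (d : ℚ) ≠ 0 := by exact_mod_cast hd
  refine ⟨(d : ℚ), hd', ?_⟩
  ext i j
  simp [-zsmul_eq_mul, -zsmul_one]

lemma isSymm (h : IsNonzeroRationalMultiple A B) (hA : A.IsSymm) : B.IsSymm := by
  obtain ⟨r, hr, e⟩ := h
  refine Matrix.IsSymm.ext fun i j => ?_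
  have h1 := congrFun (congrFun e i) j
  have h2 := congrFun (congrFun e j) i
  simp only [Matrix.map_apply, Matrix.smul_apply, smul_eq_mul] at h1 h2
  rw [hA.apply i j] at h2
  have := mul_left_cancel₀ hr (h1.symm.trans h2)
  exact_mod_cast this.symm

end IsNonzeroRationalMultiple

lemma isSymm_symMat (x : Fin 3 → ℤ) : (symMat x).IsSymm := by
  refine Matrix.IsSymm.ext fun i j => ?_
  fin_cases i <;> fin_cases j <;> simp [symMat]

lemma transpose_alternating (M : Matrix (Fin 2) (Fin 2) ℤ) (k : ℕ) :
    (alternating M k)ᵀ = alternating M (k + 1) := by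
  by_cases h : Even k <;> simp [alternating, h, Nat.even_add_one]

/-- Transposing the hypothesis gives x ∼ z ᵗA y. Substituted for the last factor of -xJzJx, this
produces JzJz = -det(z), leaving x ᵗA y. -/
lemma bracket_step {x y z : Fin 3 → ℤ} {A : Matrix (Fin 2) (Fin 2) ℤ}
    (hz : (symMat z).det ≠ 0)
    (h : IsNonzeroRationalMultiple (symMat x) (symMat y * A * symMat z)) :
    IsNonzeroRationalMultiple (bracket x x z) (symMat x * Aᵀ * symMat y) := by
  have h1 := h.transpose
  rw [isSymm_symMat x, Matrix.transpose_mul, Matrix.transpose_mul, isSymm_symMat y,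
    isSymm_symMat z] at h1
  have h2 := h1.mul_left (-(symMat x * matJ * symMat z * matJ))
  have e : -(symMat x * matJ * symMat z * matJ) * (symMat z * (Aᵀ * symMat y)) =
      (symMat z).det • (symMat x * Aᵀ * symMat y) := by
    have : matJ * symMat z * matJ * symMat z = -((symMat z).det • 1) := by
      ext i j
      rw [det_symMat]
      fin_cases i <;> fin_cases j <;> simp [matJ, symMat, -zsmul_eq_mul, -zsmul_one] <;> ring
    calc _ = -(symMat x * (matJ * symMat z * matJ * symMat z) * Aᵀ * symMat y) := by
          simp only [Matrix.mul_assoc, Matrix.neg_mul]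
      _ = _ := by
          rw [this]
          simp [Matrix.mul_assoc, -zsmul_eq_mul, -zsmul_one]
  rw [e] at h2
  have h3 := h2.trans (IsNonzeroRationalMultiple.smul_right hz)
  unfold bracket
  rwa [Matrix.neg_mul] at h3

/-- For symmetric M the antisymmetric part of xMy is, up to sign, this determinant. -/
lemma det_eq_zero_of_isSymm_mul {x y : Fin 3 → ℤ} {M : Matrix (Fin 2) (Fin 2) ℤ} (hM : M.IsSymm)
    (h : (symMat x * M * symMat y).IsSymm) :
    (Matrix.of ![![M 1 1, -M 0 1, M 0 0], x, y]).det = 0 := by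
  have h1 := h.apply 0 1
  have h2 := hM.apply 0 1
  simp [symMat, Matrix.mul_apply, Matrix.vecMul, dotProduct, Fin.sum_univ_two] at h1
  rw [Matrix.det_fin_three]
  simp
  rw [h2] at h1
  linarith

/-- If `y_{k+1} ∼ [y_k, y_k, y_{k-2}]` for large `k` then `y_{k+1} ∼ y_k M_k y_{k-1}` for some
fixed non-symmetric `M`. -/
theorem exists_alternating_of_bracket {y : ℕ → Fin 3 → ℤ} {k₀ : ℕ} (hk₀ : 3 ≤ k₀)
    (hdet : ∀ k, 1 ≤ k → (symMat (y k)).det ≠ 0)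
    (hdet₃ : ∀ k, 1 ≤ k → (Matrix.of ![y k, y (k + 1), y (k + 2)]).det ≠ 0)
    (h : ∀ k, k₀ ≤ k → IsNonzeroRationalMultiple (symMat (y (k + 1)))
      (bracket (y k) (y k) (y (k - 2)))) :
    ∃ M : Matrix (Fin 2) (Fin 2) ℤ, ¬ M.IsSymm ∧ M.det ≠ 0 ∧ ∀ k : ℕ, k₀ ≤ k →
      IsNonzeroRationalMultiple (symMat (y (k + 1)))
        (symMat (y k) * alternating M k * symMat (y (k - 1))) := by
  -- Adjugates stand in for inverses, so that the solution at index k₀ has integer entries. The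
  -- parity of k₀ then decides whether it serves as M or as ᵗM.
  set M' := (symMat (y k₀)).adjugate * symMat (y (k₀ + 1)) * (symMat (y (k₀ - 1))).adjugate with hM'
  obtain ⟨M, hM⟩ : ∃ M, alternating M k₀ = M' := by
    by_cases he : Even k₀
    · exact ⟨M', by simp [alternating, he]⟩
    · exact ⟨M'ᵀ, by simp [alternating, he]⟩
  have hdetM' : M'.det ≠ 0 := by
    rw [hM', Matrix.det_mul, Matrix.det_mul, Matrix.det_adjugate, Matrix.det_adjugate]
    simp [hdet k₀ (by omega), hdet (k₀ + 1) (by omega), hdet (k₀ - 1) (by omega)]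
  have hdetM : M.det ≠ 0 := by
    rw [← hM] at hdetM'
    unfold alternating at hdetM'
    split_ifs at hdetM'
    · exact hdetM'
    · rwa [Matrix.det_transpose] at hdetM'
  have main : ∀ k : ℕ, k₀ ≤ k → IsNonzeroRationalMultiple (symMat (y (k + 1)))
        (symMat (y k) * alternating M k * symMat (y (k - 1))) := by
    intro k hk
    induction k, hk using Nat.le_induction with
    | base =>
      rw [hM]
      refine IsNonzeroRationalMultiple.of_smul_eq
        (mul_ne_zero (hdet k₀ (by omega)) (hdet (k₀ - 1) (by omega))) ?_
      calc _ = (symMat (y k₀) * (symMat (y k₀)).adjugate) * symMat (y (k₀ + 1)) *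
            ((symMat (y (k₀ - 1))).adjugate * symMat (y (k₀ - 1))) := by
            rw [Matrix.mul_adjugate, Matrix.adjugate_mul]
            simp [smul_smul, mul_comm, -zsmul_eq_mul, -zsmul_one]
        _ = _ := by rw [hM']; simp only [Matrix.mul_assoc]
    | succ k hk ih =>
      have h1 := h (k + 1) (by omega)
      rw [show k + 1 - 2 = k - 1 by omega] at h1
      rw [Nat.add_sub_cancel, ← transpose_alternating]
      exact h1.trans (bracket_step (hdet _ (by omega)) ih)
  refine ⟨M, fun hsymm => ?_, hdetM, main⟩
  have halt : ∀ k, alternating M k = M := fun k => by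
    unfold alternating; split_ifs; exacts [rfl, hsymm]
  set n : Fin 3 → ℤ := ![M 1 1, -M 0 1, M 0 0] with hn
  have hn0 : n ≠ 0 := by
    intro h0
    have e0 := congrFun h0 0
    have e1 := congrFun h0 1
    simp [hn] at e0 e1
    exact hdetM (by rw [Matrix.det_fin_two, e0, e1]; ring)
  have hplane : ∀ k, k₀ ≤ k → (Matrix.of ![n, y (k - 1), y k]).det = 0 := by
    intro k hk
    have h1 := (main k hk).isSymm (isSymm_symMat _)
    rw [halt] at h1
    have h2 := det_eq_zero_of_isSymm_mul hsymm h1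
    rw [Matrix.det_fin_three] at h2 ⊢
    simp [← hn] at h2 ⊢
    linarith
  -- The fixed vector n lies in the planes of (y_{k-1}, y_k) and of (y_k, y_{k+1}), which meet in
  -- the line of y_k.
  have hpar : ∀ k, k₀ ≤ k → y k ⨯₃ n = 0 := by
    intro k hk
    have h3 := hdet₃ (k - 1) (by omega)
    rw [show k - 1 + 1 = k by omega, show k - 1 + 2 = k + 1 by omega] at h3
    exact crossProduct_eq_zero_of_det_eq_zero h3 (hplane k hk)
      (by simpa using hplane (k + 1) (by omega))
  have h1 := hpar k₀ le_rfl
  have h2 := hpar (k₀ + 1) (by omega)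
  rw [← neg_eq_zero, cross_anticomm] at h1 h2
  obtain ⟨r, hr⟩ := exists_rat_mul_of_crossProduct_eq_zero hn0 h1
  obtain ⟨s, hs⟩ := exists_rat_mul_of_crossProduct_eq_zero hn0 h2
  refine hdet₃ k₀ (by omega) ?_
  have : (((Matrix.of ![y k₀, y (k₀ + 1), y (k₀ + 2)]).det : ℤ) : ℚ) = 0 := by
    rw [Matrix.det_fin_three]
    simp
    rw [hr 0, hr 1, hr 2, hs 0, hs 1, hs 2]
    ring
  exact_mod_cast this

/-! ### Numerical exponents and logarithmic growth. -/

lemma one_div_goldenRatio_lt : 1 / Real.goldenRatio < 0.619 := by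
  have h5 : (2.236 : ℝ) < √5 := Real.lt_sqrt_of_sq_lt (by norm_num)
  rw [div_lt_iff₀ Real.goldenRatio_pos]
  unfold Real.goldenRatio
  linarith

lemma le_thetaOf {lam : ℝ} (h : 0.61455261 < lam) (h' : lam < 0.619) : 1.594 ≤ thetaOf lam := by
  unfold thetaOf
  rw [le_div_iff₀ (by linarith)]
  linarith

lemma one_div_thetaOf_sub_one_le {lam : ℝ} (h : 0.61455261 < lam) (h' : lam < 0.619) :
    1 / (thetaOf lam - 1) ≤ 1.683 := by
  -- The cruder bound 1.594 would not give 1.683.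
  have : 1.59438 ≤ thetaOf lam := by
    unfold thetaOf
    rw [le_div_iff₀ (by linarith)]
    linarith
  rw [div_le_iff₀ (by linarith)]
  linarith

lemma le_thetaOf_sq_div {lam : ℝ} (h : 0.61455261 < lam) (h' : lam < 0.619) :
    0.979 ≤ thetaOf lam ^ 2 / (thetaOf lam + 1) := by
  have := le_thetaOf h h'
  rw [le_div_iff₀ (by linarith)]
  nlinarith

lemma log_le_of_le_mul_rpow {u Y c e : ℝ} (hu : 0 < u) (hY : 0 < Y) (hc : 0 < c)
    (h : u ≤ c * Y ^ e) : Real.log u ≤ e * Real.log Y + Real.log c := by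
  have := Real.log_le_log hu h
  rw [Real.log_mul hc.ne' (Real.rpow_pos_of_pos hY e).ne', Real.log_rpow hY] at this
  linarith

/-- The growth conditions used to identify the points of an approximation sequence, in
logarithmic form: `l k = log ‖y_k‖` and `m k = log L(y_k)`. -/
structure LogGrowth (C : ℝ) (l m : ℕ → ℝ) : Prop where
  nonneg : ∀ k, 1 ≤ k → 0 ≤ l k
  lower : ∀ k, 1 ≤ k → 1.594 * l k - C ≤ l (k + 1)
  upper : ∀ k, 1 ≤ k → l (k + 1) ≤ 1.683 * l k + C
  small : ∀ k, 1 ≤ k → m k ≤ -0.979 * l k + C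

/-- Above the threshold 2C + 1 the lower growth condition forces an increase of at least 1/2 at each
step, so one large term suffices. -/
lemma LogGrowth.tendsto {C : ℝ} {l m : ℕ → ℝ} (hC : 0 ≤ C) (h : LogGrowth C l m)
    (hu : ∀ B : ℝ, ∃ k, 1 ≤ k ∧ B < l k) : Tendsto l atTop atTop := by
  obtain ⟨k₀, hk₀, hB⟩ := hu (2 * C + 1)
  have key : ∀ n : ℕ, 2 * C + 1 + n / 2 ≤ l (k₀ + n) := by
    intro n
    induction n with
    | zero => simpa using hB.le
    | succ n ih =>
      have := h.lower (k₀ + n) (by omega)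
      rw [← add_assoc]
      push_cast
      have : (0 : ℝ) ≤ n := n.cast_nonneg
      linarith
  have h1 : Tendsto (fun n : ℕ => l (n + k₀)) atTop atTop := by
    refine tendsto_atTop_mono (f := fun n : ℕ => (n : ℝ) * (1 / 2)) (fun n => ?_) ?_
    · have := key n
      rw [add_comm k₀ n] at this
      linarith
    · exact tendsto_natCast_atTop_atTop.atTop_mul_const (by norm_num)
  exact (tendsto_add_atTop_iff_nat k₀).1 h1

section

variable {ξ lam : ℝ} {y : ℕ → Fin 3 → ℤ}

lemma IsApproximationSequence.det_ne_zero (h : IsApproximationSequence ξ lam y) (k : ℕ)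
    (hk : 1 ≤ k) : (symMat (y k)).det ≠ 0 := by
  have := h.det_lower k hk
  intro h0
  simp [h0] at this

lemma IsApproximationSequence.det₃_ne_zero (h : IsApproximationSequence ξ lam y) (k : ℕ)
    (hk : 1 ≤ k) : (Matrix.of ![y k, y (k + 1), y (k + 2)]).det ≠ 0 := by
  have := h.det₃_lower k hk
  intro h0
  rw [h0] at this
  simp at this

lemma IsApproximationSequence.ne_zero (h : IsApproximationSequence ξ lam y) (k : ℕ)
    (hk : 1 ≤ k) : y k ≠ 0 := ne_zero_of_det_symMat_ne_zero (h.det_ne_zero k hk)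

lemma IsApproximationSequence.LInf_pos (h : IsApproximationSequence ξ lam y) (k : ℕ)
    (hk : 1 ≤ k) : 0 < LInf ξ (y k) := by
  obtain ⟨c, hc, h1⟩ := h.LInf_lower
  have h2 := h1 k hk
  have h3 : 0 < ‖y k‖ := zero_lt_one.trans_le (one_le_norm (h.ne_zero k hk))
  have h4 := Real.rpow_pos_of_pos h3 (-1)
  by_contra h5
  have : LInf ξ (y k) = 0 := le_antisymm (not_lt.1 h5) (LInf_nonneg _ _)
  simp only [this, mul_zero] at h2
  linarith

lemma IsApproximationSequence.exists_logGrowth (h : IsApproximationSequence ξ lam y)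
    (h1 : 0.61455261 < lam) (h2 : lam < 0.619) : ∃ C, 0 ≤ C ∧
      LogGrowth C (fun k => Real.log ‖y k‖) (fun k => Real.log (LInf ξ (y k))) := by
  obtain ⟨c₁, hc₁, i₁⟩ := h.norm_lower
  obtain ⟨c₂, hc₂, i₂⟩ := h.norm_upper
  obtain ⟨c₃, hc₃, i₃⟩ := h.LInf_upper
  have hone : ∀ k, 1 ≤ k → 1 ≤ ‖y k‖ := fun k hk => one_le_norm (h.ne_zero k hk)
  have hpos : ∀ k, 1 ≤ k → 0 < ‖y k‖ := fun k hk => zero_lt_one.trans_le (hone k hk)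
  have hl : ∀ k, 1 ≤ k → 0 ≤ Real.log ‖y k‖ := fun k hk => Real.log_nonneg (hone k hk)
  refine ⟨|Real.log c₁| + |Real.log c₂| + |Real.log c₃|, by positivity, hl, ?_, ?_, ?_⟩
  · intro k hk
    have a := i₁ k hk
    have hp := hpos (k + 1) (by omega)
    have b := Real.log_le_log (Real.rpow_pos_of_pos (hpos k hk) _) a
    rw [Real.log_mul hc₁.ne' hp.ne', Real.log_rpow (hpos k hk)] at b
    have c := mul_le_mul_of_nonneg_right (le_thetaOf h1 h2) (hl k hk)
    have := le_abs_self (Real.log c₁)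
    have := abs_nonneg (Real.log c₂)
    have := abs_nonneg (Real.log c₃)
    linarith
  · intro k hk
    have b := log_le_of_le_mul_rpow (hpos (k + 1) (by omega)) (hpos k hk) hc₂ (i₂ k hk)
    have c := mul_le_mul_of_nonneg_right (one_div_thetaOf_sub_one_le h1 h2) (hl k hk)
    have := le_abs_self (Real.log c₂)
    have := abs_nonneg (Real.log c₁)
    have := abs_nonneg (Real.log c₃)
    linarith
  · intro k hk
    have b := log_le_of_le_mul_rpow (h.LInf_pos k hk) (hpos k hk) hc₃ (i₃ k hk)
    have c := mul_le_mul_of_nonneg_right (le_thetaOf_sq_div h1 h2) (hl k hk)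
    have := le_abs_self (Real.log c₃)
    have := abs_nonneg (Real.log c₁)
    have := abs_nonneg (Real.log c₂)
    linarith

end

/-! ### Vanishing determinants and the bracket recurrence. -/

/-- The three terms of `abs_det₃_le` add up to at most 6e⁻² < 1, and the determinant is an integer.
-/
lemma det₃_eq_zero_of_le_exp {ξ a a' b b' c c' : ℝ} {w u v : Fin 3 → ℤ}
    (hw : ‖w‖ ≤ Real.exp a) (hw' : LInf ξ w ≤ Real.exp a')
    (hu : ‖u‖ ≤ Real.exp b) (hu' : LInf ξ u ≤ Real.exp b')
    (hv : ‖v‖ ≤ Real.exp c) (hv' : LInf ξ v ≤ Real.exp c')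
    (h₁ : a + b' + c' ≤ -2) (h₂ : b + a' + c' ≤ -2) (h₃ : c + a' + b' ≤ -2) :
    (Matrix.of ![w, u, v]).det = 0 := by
  have key : ∀ {p q r x y z : ℝ}, 0 ≤ y → 0 ≤ z → x ≤ Real.exp p → y ≤ Real.exp q →
      z ≤ Real.exp r → p + q + r ≤ -2 → x * y * z ≤ Real.exp (-2) := by
    intro p q r x y z hy hz h1 h2 h3 h
    calc x * y * z ≤ Real.exp p * Real.exp q * Real.exp r := by gcongr
      _ = Real.exp (p + q + r) := by rw [Real.exp_add, Real.exp_add]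
      _ ≤ _ := Real.exp_le_exp.2 h
  have k1 := key (LInf_nonneg ξ u) (LInf_nonneg ξ v) hw hu' hv' h₁
  have k2 := key (LInf_nonneg ξ w) (LInf_nonneg ξ v) hu hw' hv' h₂
  have k3 := key (LInf_nonneg ξ w) (LInf_nonneg ξ u) hv hw' hu' h₃
  have h2 : Real.exp (-2) < 1 / 6 := by
    rw [Real.exp_neg, ← one_div]
    refine one_div_lt_one_div_of_lt (by norm_num) ?_
    rw [show (2 : ℝ) = 1 + 1 by norm_num, Real.exp_add]
    nlinarith [Real.exp_one_gt_d9]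
  have hd := abs_det₃_le ξ w u v
  have : ((|(Matrix.of ![w, u, v]).det| : ℤ) : ℝ) < 1 := by linarith
  exact Int.abs_lt_one_iff.1 (by exact_mod_cast this)

lemma mul_add_le_exp {c p q P Q E : ℝ} (hc : 0 < c) (hp : p ≤ Real.exp P) (hq : q ≤ Real.exp Q)
    (hP : P ≤ E) (hQ : Q ≤ E) : c * (p + q) ≤ Real.exp (E + Real.log (2 * c)) := by
  rw [Real.exp_add, Real.exp_log (by positivity)]
  have := hp.trans (Real.exp_le_exp.2 hP)
  have := hq.trans (Real.exp_le_exp.2 hQ)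
  nlinarith

section

variable {ξ lam : ℝ} {y : ℕ → Fin 3 → ℤ}

lemma IsApproximationSequence.eventually_bracketPoint (h : IsApproximationSequence ξ lam y)
    (h1 : 0.61455261 < lam) (h2 : lam < 0.619) :
    ∀ᶠ k in atTop, y (k + 1) ⨯₃ bracketPoint (y (k + 3)) (y (k + 4)) = 0 := by
  obtain ⟨C, hC, hg⟩ := h.exists_logGrowth h1 h2
  have hY : ∀ k, 1 ≤ k → ‖y k‖ = Real.exp (Real.log ‖y k‖) := fun k hk =>
    (Real.exp_log (zero_lt_one.trans_le (one_le_norm (h.ne_zero k hk)))).symm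
  have hL : ∀ k, 1 ≤ k → LInf ξ (y k) = Real.exp (Real.log (LInf ξ (y k))) := fun k hk =>
    (Real.exp_log (h.LInf_pos k hk)).symm
  set l := fun k => Real.log ‖y k‖ with hl
  set m := fun k => Real.log (LInf ξ (y k)) with hm
  have hlim : Tendsto l atTop atTop := by
    refine hg.tendsto hC fun B => ?_
    obtain ⟨k, hk, hB⟩ := h.unbounded (Real.exp B)
    refine ⟨k, hk, ?_⟩
    rw [hY k hk] at hB
    exact Real.exp_lt_exp.1 hB
  set K := powBound ξ with hK
  have hKpos : 0 < K := powBound_pos ξ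
  set D := |Real.log (2 * (100 * K ^ 4))| + |Real.log (2 * (24 * K ^ 3))| with hD
  have hlim' := (tendsto_add_atTop_iff_nat 3).2 hlim
  -- The tightest term is Y_{k+2} L(w) L(y_{k+1}), with exponent (1 - 0.979/1.683)/1.594 - 0.275 ≈
  -- -0.0126 relative to Y_{k+3}. The factor 100 lets this margin absorb all constants.
  filter_upwards [hlim'.eventually_ge_atTop (100 * (20 * C + D + 2)), eventually_ge_atTop 1]
    with k hbig hk
  have g0 := hg.nonneg k hk
  have g3 := hg.nonneg (k + 3) (by omega)
  have a0 := hg.lower k hk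
  have a1 := hg.lower (k + 1) (by omega)
  have a2 := hg.lower (k + 2) (by omega)
  have a3 := hg.lower (k + 3) (by omega)
  have b0 := hg.upper k hk
  have b1 := hg.upper (k + 1) (by omega)
  have b2 := hg.upper (k + 2) (by omega)
  have b3 := hg.upper (k + 3) (by omega)
  have c0 := hg.small k hk
  have c1 := hg.small (k + 1) (by omega)
  have c2 := hg.small (k + 2) (by omega)
  have c3 := hg.small (k + 3) (by omega)
  have c4 := hg.small (k + 4) (by omega)
  simp only [add_assoc, Nat.reduceAdd] at a0 a1 a2 a3 b0 b1 b2 b3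
  have Y0 := (hY k hk).le
  have Y1 := (hY (k + 1) (by omega)).le
  have Y2 := (hY (k + 2) (by omega)).le
  have Y3 := hY (k + 3) (by omega)
  have Y4 := hY (k + 4) (by omega)
  have L0 := (hL k hk).le
  have L1 := (hL (k + 1) (by omega)).le
  have L2 := (hL (k + 2) (by omega)).le
  have L3 := hL (k + 3) (by omega)
  have L4 := hL (k + 4) (by omega)
  have e1 : ‖y (k + 3)‖ ^ 2 * LInf ξ (y (k + 4)) = Real.exp (l (k + 3) + l (k + 3) + m (k + 4)) := by
    rw [Real.exp_add, Real.exp_add, ← Y3, ← L4, sq]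
  have e2 : ‖y (k + 4)‖ * LInf ξ (y (k + 3)) ^ 2 = Real.exp (l (k + 4) + m (k + 3) + m (k + 3)) := by
    rw [Real.exp_add, Real.exp_add, ← Y4, ← L3]; ring
  have e3 : ‖y (k + 3)‖ * LInf ξ (y (k + 4)) * LInf ξ (y (k + 3)) =
      Real.exp (l (k + 3) + m (k + 4) + m (k + 3)) := by
    rw [Real.exp_add, Real.exp_add, ← Y3, ← L4, ← L3]
  -- Here 2 - 0.979 · 1.594 < 0.44; in the next bound, 1.683 - 2 · 0.979 = -0.275.
  have w1 := (norm_bracketPoint_le ξ (y (k + 3)) (y (k + 4))).trans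
    (mul_add_le_exp (E := 0.44 * l (k + 3) + 4 * C) (by positivity) e1.le e2.le
      (by linarith) (by linarith))
  have w2 : LInf ξ (bracketPoint (y (k + 3)) (y (k + 4))) ≤
      Real.exp (-0.275 * l (k + 3) + 4 * C + Real.log (2 * (24 * K ^ 3))) := by
    refine (LInf_bracketPoint_le ξ (y (k + 3)) (y (k + 4))).trans ?_
    rw [add_mul, mul_assoc ‖y (k + 4)‖, ← sq]
    exact mul_add_le_exp (by positivity) e3.le e2.le (by linarith) (by linarith)
  have d1 := le_abs_self (Real.log (2 * (100 * K ^ 4)))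
  have d2 := le_abs_self (Real.log (2 * (24 * K ^ 3)))
  have d3 := abs_nonneg (Real.log (2 * (100 * K ^ 4)))
  have d4 := abs_nonneg (Real.log (2 * (24 * K ^ 3)))
  have hdet := h.det₃_ne_zero k hk
  refine crossProduct_eq_zero_of_det_eq_zero hdet ?_ ?_
  · exact det₃_eq_zero_of_le_exp w1 w2 Y0 L0 Y1 L1 (by linarith) (by linarith) (by linarith)
  · exact det₃_eq_zero_of_le_exp w1 w2 Y1 L1 Y2 L2 (by linarith) (by linarith) (by linarith)

theorem IsApproximationSequence.exists_bracket (h : IsApproximationSequence ξ lam y)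
    (h1 : 0.61455261 < lam) (h2 : lam < 0.619) :
    ∃ k₀ : ℕ, 3 ≤ k₀ ∧ ∀ k : ℕ, k₀ ≤ k → IsNonzeroRationalMultiple (symMat (y (k + 1)))
      (bracket (y k) (y k) (y (k - 2))) := by
  obtain ⟨N, hN⟩ := eventually_atTop.1 (h.eventually_bracketPoint h1 h2)
  refine ⟨N + 3, by omega, fun k hk => ?_⟩
  obtain ⟨n, rfl⟩ : ∃ n, k = n + 3 := ⟨k - 3, by omega⟩
  exact isNonzeroRationalMultiple_bracket (h.det_ne_zero _ (by omega)) (h.det_ne_zero _ (by omega))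
    (h.ne_zero _ (by omega)) (hN n (by omega))

end

/-! ### Primitive points and independence of 1, ξ, ξ². -/

lemma det_eq_crossProduct_dotProduct (x y z : Fin 3 → ℤ) :
    (Matrix.of ![x, y, z]).det = (x ⨯₃ y) ⬝ᵥ z := by
  rw [Matrix.det_fin_three, cross_apply]
  simp [dotProduct, Fin.sum_univ_three]
  ring

lemma IsPrimitivePoint.exists_dotProduct_eq_one {x : Fin 3 → ℤ} (hx : IsPrimitivePoint x) :
    ∃ u : Fin 3 → ℤ, u ⬝ᵥ x = 1 := by
  obtain ⟨d, hd⟩ := IsPrincipalIdealRing.principal (Ideal.span (Set.range x))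
  have hdvd : ∀ i, d ∣ x i := fun i => by
    have h1 : x i ∈ Ideal.span (Set.range x) := Ideal.subset_span ⟨i, rfl⟩
    rw [hd] at h1
    exact Ideal.mem_span_singleton.1 h1
  have hu := hx d hdvd
  have h1 : (1 : ℤ) ∈ Ideal.span (Set.range x) := by
    rw [hd]
    exact Ideal.mem_span_singleton.2 hu.dvd
  obtain ⟨u, hu⟩ := (Ideal.mem_span_range_iff_exists_fun (R := ℤ)).1 h1
  exact ⟨u, by simpa [dotProduct] using hu⟩

/-- With a Bézout vector u, u · x = 1, the multiplier is u · y. -/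
lemma IsPrimitivePoint.exists_eq_smul {x y : Fin 3 → ℤ} (hx : IsPrimitivePoint x)
    (h : x ⨯₃ y = 0) : ∃ t : ℤ, y = t • x := by
  obtain ⟨u, hu⟩ := hx.exists_dotProduct_eq_one
  refine ⟨u ⬝ᵥ y, funext fun i => ?_⟩
  have e := mul_apply_comm_of_crossProduct_eq_zero h
  simp only [dotProduct, Fin.sum_univ_three, Pi.smul_apply, smul_eq_mul] at hu ⊢
  linear_combination (-y i) * hu - u 0 * e i 0 - u 1 * e i 1 - u 2 * e i 2

lemma norm_int_smul (t : ℤ) (x : Fin 3 → ℤ) : ‖t • x‖ = |(t : ℝ)| * ‖x‖ := by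
  rw [norm_smul, Int.norm_eq_abs]

lemma LInf_smul (ξ : ℝ) (t : ℤ) (x : Fin 3 → ℤ) : LInf ξ (t • x) = |(t : ℝ)| * LInf ξ x := by
  unfold LInf
  rw [← Real.norm_eq_abs, ← norm_smul]
  congr 1
  ext i
  simp
  ring

/-- The numbers `1, ξ, ξ²` are linearly independent over `ℚ`. -/
def IndepPowers (ξ : ℝ) : Prop :=
  ∀ n : Fin 3 → ℤ, (n 0 : ℝ) + n 1 * ξ + n 2 * ξ ^ 2 = 0 → n = 0

lemma indepPowers_of_two_lt_rank {ξ : ℝ}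
    (h : 2 < Module.rank ℚ (IntermediateField.adjoin ℚ ({ξ} : Set ℝ))) : IndepPowers ξ := by
  have hcoeff : ∀ a b c : ℚ, Polynomial.C a * Polynomial.X ^ 2 + Polynomial.C b * Polynomial.X +
      Polynomial.C c = 0 → a = 0 ∧ b = 0 ∧ c = 0 := by
    intro a b c h0
    have c0 := congrArg (Polynomial.coeff · 0) h0
    have c1 := congrArg (Polynomial.coeff · 1) h0
    have c2 := congrArg (Polynomial.coeff · 2) h0
    simp [Polynomial.coeff_X, Polynomial.coeff_C] at c0 c1 c2
    exact ⟨c2, c1, c0⟩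
  intro n hn
  by_contra hne
  set p : Polynomial ℚ := Polynomial.C (n 2 : ℚ) * Polynomial.X ^ 2 +
    Polynomial.C (n 1 : ℚ) * Polynomial.X + Polynomial.C (n 0 : ℚ) with hp
  have hp0 : p ≠ 0 := by
    intro h0
    apply hne
    obtain ⟨c2, c1, c0⟩ := hcoeff _ _ _ h0
    ext i
    fin_cases i
    exacts [by exact_mod_cast c0, by exact_mod_cast c1, by exact_mod_cast c2]
  have hroot : Polynomial.aeval ξ p = 0 := by
    simp [hp]
    linarith
  have hint : IsIntegral ℚ ξ := isAlgebraic_iff_isIntegral.1 ⟨p, hp0, hroot⟩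
  have hdeg : (minpoly ℚ ξ).natDegree ≤ 2 :=
    (Polynomial.natDegree_le_of_dvd (minpoly.dvd ℚ ξ hroot) hp0).trans
      Polynomial.natDegree_quadratic_le
  have hfin := IntermediateField.adjoin.finrank hint
  have := IntermediateField.adjoin.finiteDimensional hint
  rw [← Module.finrank_eq_rank, hfin] at h
  have : 2 < (minpoly ℚ ξ).natDegree := by exact_mod_cast h
  omega

lemma IndepPowers.LInf_pos {ξ : ℝ} (h : IndepPowers ξ) {x : Fin 3 → ℤ} (hx : x ≠ 0) :
    0 < LInf ξ x := by
  refine lt_of_le_of_ne (LInf_nonneg ξ x) fun h0 => hx ?_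
  obtain ⟨a, b, ha, hb, h1, h2⟩ := exists_deviation ξ x
  rw [← h0] at ha hb
  rw [abs_nonpos_iff.1 ha, add_zero] at h1
  rw [abs_nonpos_iff.1 hb, add_zero] at h2
  have h3 := h ![x 1, -x 0, 0] (by simp; linarith)
  have e1 : x 1 = 0 := congrFun h3 0
  have e0 : x 0 = 0 := by simpa using congrFun h3 1
  rw [e0] at h2
  have e2 : x 2 = 0 := by simpa using h2
  ext i
  fin_cases i
  exacts [e0, e1, e2]

lemma IsExponentOfApproximation.exists_LInf_lt {ξ lam : ℝ} (h : IsExponentOfApproximation ξ lam)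
    (hlam : 0 < lam) {ε : ℝ} (hε : 0 < ε) : ∃ x : Fin 3 → ℤ, x ≠ 0 ∧ LInf ξ x < ε := by
  obtain ⟨c, hc, h⟩ := h
  have h1 : Tendsto (fun X : ℝ => c * X ^ (-lam)) atTop (𝓝 (c * 0)) :=
    (tendsto_rpow_neg_atTop hlam).const_mul c
  rw [mul_zero] at h1
  obtain ⟨X, hX, hX1⟩ := ((h1.eventually_lt_const hε).and (eventually_ge_atTop 1)).exists
  obtain ⟨x, hx, -, hL⟩ := h X hX1
  exact ⟨x, hx, hL.trans_lt hX⟩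

/-! ### Minimal points. -/

lemma finite_setOf_norm_le (B : ℝ) : {x : Fin 3 → ℤ | ‖x‖ ≤ B}.Finite := by
  have : {x : Fin 3 → ℤ | ‖x‖ ≤ B} = Metric.closedBall 0 B := by
    ext x; simp
  rw [this]
  exact isCompact_iff_finite.1 (isCompact_closedBall _ _)

/-- `x` has minimal norm, and then minimal `L(x)`, among non-zero points with `L(x) < ε`. -/
structure IsMinimalBelow (ξ ε : ℝ) (x : Fin 3 → ℤ) : Prop where
  ne_zero : x ≠ 0
  lt : LInf ξ x < ε
  norm_le : ∀ z : Fin 3 → ℤ, z ≠ 0 → LInf ξ z < ε → ‖x‖ ≤ ‖z‖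
  LInf_le : ∀ z : Fin 3 → ℤ, z ≠ 0 → LInf ξ z < ε → ‖z‖ ≤ ‖x‖ → LInf ξ x ≤ LInf ξ z

lemma exists_isMinimalBelow {ξ ε : ℝ} (h : ∃ x : Fin 3 → ℤ, x ≠ 0 ∧ LInf ξ x < ε) :
    ∃ x, IsMinimalBelow ξ ε x := by
  obtain ⟨z, hz, hzε⟩ := h
  have hfin : {x : Fin 3 → ℤ | ‖x‖ ≤ ‖z‖ ∧ x ≠ 0 ∧ LInf ξ x < ε}.Finite :=
    (finite_setOf_norm_le ‖z‖).subset fun x hx => hx.1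
  obtain ⟨x, ⟨hxz, hx0, hxε⟩, hmin⟩ := Set.exists_min_image _
    (fun x => toLex (‖x‖, LInf ξ x)) hfin ⟨z, le_rfl, hz, hzε⟩
  have key : ∀ w : Fin 3 → ℤ, w ≠ 0 → LInf ξ w < ε → ‖w‖ ≤ ‖z‖ →
      ‖x‖ < ‖w‖ ∨ ‖x‖ = ‖w‖ ∧ LInf ξ x ≤ LInf ξ w := fun w hw hwε hwz =>
    Prod.Lex.toLex_le_toLex.1 (hmin w ⟨hwz, hw, hwε⟩)
  refine ⟨x, hx0, hxε, fun w hw hwε => ?_, fun w hw hwε hwx => ?_⟩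
  · rcases le_total ‖w‖ ‖z‖ with h | h
    · rcases key w hw hwε h with h | h
      exacts [h.le, h.1.le]
    · exact hxz.trans h
  · rcases key w hw hwε (hwx.trans hxz) with h | h
    exacts [absurd hwx (not_le.2 h), h.2]

lemma IsMinimalBelow.isPrimitivePoint {ξ ε : ℝ} {x : Fin 3 → ℤ} (h : IsMinimalBelow ξ ε x) :
    IsPrimitivePoint x := by
  intro d hd
  choose z hz using hd
  have hxz : x = d • z := funext fun i => by simpa using hz i
  have hz0 : z ≠ 0 := by
    rintro rfl
    exact h.ne_zero (by simpa using hxz)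
  have hd0 : d ≠ 0 := by
    rintro rfl
    exact h.ne_zero (by simpa using hxz)
  have hd1 : (1 : ℝ) ≤ |(d : ℝ)| := by exact_mod_cast Int.one_le_abs hd0
  have h1 : LInf ξ z < ε := by
    refine lt_of_le_of_lt ?_ h.lt
    rw [hxz, LInf_smul]
    exact le_mul_of_one_le_left (LInf_nonneg _ _) hd1
  have h2 := h.norm_le z hz0 h1
  rw [hxz, norm_int_smul] at h2
  have h3 : |(d : ℝ)| ≤ 1 := by
    by_contra hlt
    nlinarith [one_le_norm hz0]
  have h4 : |d| ≤ 1 := by exact_mod_cast h3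
  rw [Int.isUnit_iff_abs_eq]
  exact le_antisymm h4 (Int.one_le_abs hd0)

/-- A sequence of minimal points for `ξ`. -/
structure IsMinimalSequence (ξ : ℝ) (x : ℕ → Fin 3 → ℤ) : Prop where
  ne_zero : ∀ i, x i ≠ 0
  primitive : ∀ i, IsPrimitivePoint (x i)
  norm_lt : ∀ i, ‖x i‖ < ‖x (i + 1)‖
  LInf_lt : ∀ i, LInf ξ (x (i + 1)) < LInf ξ (x i)
  minimal : ∀ i, ∀ z : Fin 3 → ℤ, z ≠ 0 → LInf ξ z < LInf ξ (x i) → ‖x (i + 1)‖ ≤ ‖z‖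

lemma exists_isMinimalSequence {ξ : ℝ} (hξ : IndepPowers ξ)
    (h : ∀ ε : ℝ, 0 < ε → ∃ x : Fin 3 → ℤ, x ≠ 0 ∧ LInf ξ x < ε) :
    ∃ x, IsMinimalSequence ξ x := by
  have h' : ∀ ε : ℝ, 0 < ε → ∃ x, IsMinimalBelow ξ ε x := fun ε hε => exists_isMinimalBelow (h ε hε)
  choose! f hf using h'
  obtain ⟨x, hx0, hxs⟩ : ∃ x : ℕ → Fin 3 → ℤ, x 0 = f 1 ∧ ∀ n, x (n + 1) = f (LInf ξ (x n)) :=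
    ⟨fun n => Nat.rec (f 1) (fun _ p => f (LInf ξ p)) n, rfl, fun _ => rfl⟩
  have hne : ∀ i, x i ≠ 0 := by
    intro i
    induction i with
    | zero => exact hx0 ▸ (hf 1 one_pos).ne_zero
    | succ i ih => exact hxs i ▸ (hf _ (hξ.LInf_pos ih)).ne_zero
  have hx : ∀ i, IsMinimalBelow ξ (LInf ξ (x i)) (x (i + 1)) := fun i => by
    rw [hxs i]
    exact hf _ (hξ.LInf_pos (hne i))
  -- The shift gives every term a predecessor. Strict growth of the norm rests on the secondary
  -- minimality of L: a next point of equal norm would have smaller L.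
  refine ⟨fun i => x (i + 1), fun i => hne _, fun i => (hx i).isPrimitivePoint, fun i => ?_,
    fun i => (hx _).lt, fun i => (hx _).norm_le⟩
  have h1 := (hx (i + 1)).lt
  have h2 := h1.trans (hx i).lt
  refine lt_of_le_of_ne ((hx i).norm_le _ (hne _) h2) fun h3 => ?_
  exact absurd ((hx i).LInf_le _ (hne _) h2 h3.ge) (not_le.2 h1)

namespace IsMinimalSequence

variable {ξ : ℝ} {x : ℕ → Fin 3 → ℤ}

lemma norm_strictMono (h : IsMinimalSequence ξ x) : StrictMono fun i => ‖x i‖ :=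
  strictMono_nat_of_lt_succ h.norm_lt

lemma LInf_strictAnti (h : IsMinimalSequence ξ x) : StrictAnti fun i => LInf ξ (x i) :=
  strictAnti_nat_of_succ_lt h.LInf_lt

lemma tendsto_norm (h : IsMinimalSequence ξ x) : Tendsto (fun i => ‖x i‖) atTop atTop := by
  have hinj : Function.Injective x := fun i j hij => h.norm_strictMono.injective (by simp [hij])
  have h1 := hinj.tendsto_cofinite
  rw [Nat.cofinite_eq_atTop, ← Filter.cocompact_eq_cofinite] at h1
  exact (tendsto_norm_cocompact_atTop).comp h1

/-- By primitivity, a later parallel point would be a non-zero integer multiple of x_i, so L could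
not have decreased. -/
lemma crossProduct_ne_zero (h : IsMinimalSequence ξ x) {i j : ℕ} (hij : i < j) :
    x i ⨯₃ x j ≠ 0 := by
  intro h0
  obtain ⟨t, ht⟩ := (h.primitive i).exists_eq_smul h0
  have ht0 : t ≠ 0 := by
    rintro rfl
    exact h.ne_zero j (by simpa using ht)
  have h1 := h.LInf_strictAnti hij
  simp only [ht, LInf_smul] at h1
  have : (1 : ℝ) ≤ |(t : ℝ)| := by exact_mod_cast Int.one_le_abs ht0
  nlinarith [LInf_nonneg ξ (x i)]

lemma exists_log_LInf_le (h : IsMinimalSequence ξ x) (hξ : IndepPowers ξ) {lam : ℝ}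
    (hlam : 0 < lam) (he : IsExponentOfApproximation ξ lam) :
    ∃ C : ℝ, ∀ i, Real.log (LInf ξ (x i)) ≤ -lam * Real.log ‖x (i + 1)‖ + C := by
  obtain ⟨c, hc, he⟩ := he
  refine ⟨Real.log c + lam * Real.log 2, fun i => ?_⟩
  have h1 : 1 < ‖x (i + 1)‖ := (one_le_norm (h.ne_zero i)).trans_lt (h.norm_lt i)
  -- Any X below ‖x_{i+1}‖ and comparable to it would do: by minimality no non-zero point of norm at
  -- most X beats L(x_i).
  obtain ⟨z, hz, hzX, hzL⟩ := he (max 1 (‖x (i + 1)‖ / 2)) (le_max_left _ _)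
  have h2 : LInf ξ (x i) ≤ LInf ξ z := by
    by_contra hlt
    refine absurd (h.minimal i z hz (not_le.1 hlt)) (not_le.2 (hzX.trans_lt ?_))
    exact max_lt h1 (by linarith)
  have hXpos : 0 < max 1 (‖x (i + 1)‖ / 2) := lt_max_of_lt_left one_pos
  have h3 := log_le_of_le_mul_rpow (hξ.LInf_pos (h.ne_zero i)) hXpos hc (h2.trans hzL)
  have h4 : Real.log (‖x (i + 1)‖ / 2) ≤ Real.log (max 1 (‖x (i + 1)‖ / 2)) :=
    Real.log_le_log (by linarith) (le_max_right _ _)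
  rw [Real.log_div (by linarith) (by norm_num)] at h4
  nlinarith

end IsMinimalSequence

/-! ### Minimal points have non-zero determinant from some index on. -/

lemma int_eq_zero_of_mul_eq_sq {a b p : ℤ} (h : a * b = p ^ 2) {A B : ℝ} (hA : A ≤ |(a : ℝ)|)
    (hB : |(p : ℝ)| ≤ B) (hAB : B ^ 2 < A) : p = 0 := by
  by_contra hp
  have hb : b ≠ 0 := by
    rintro rfl
    rw [mul_zero] at h
    exact hp (pow_eq_zero_iff two_ne_zero |>.1 h.symm)
  have hb1 : (1 : ℝ) ≤ |(b : ℝ)| := by exact_mod_cast Int.one_le_abs hb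
  have h1 : |(a : ℝ)| * |(b : ℝ)| = |(p : ℝ)| ^ 2 := by
    rw [← abs_mul, ← abs_pow]
    congr 1
    exact_mod_cast h
  nlinarith [abs_nonneg (a : ℝ), abs_nonneg (p : ℝ)]

/-- A point of determinant zero is parallel to any other point of small enough norm. -/
lemma crossProduct_eq_zero_of_det_symMat_eq_zero {ξ : ℝ} {x z : Fin 3 → ℤ}
    (hx : (symMat x).det = 0) (hx1 : 2 * LInf ξ x ≤ ‖x‖) (hnorm : ‖z‖ ≤ ‖x‖)
    (hL : LInf ξ x ≤ LInf ξ z) (hsmall : 32 * powBound ξ ^ 3 * (‖x‖ * LInf ξ z ^ 2) < 1)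
    (hpos : 0 < ‖x‖) : z ⨯₃ x = 0 := by
  have hK := one_le_powBound ξ
  have hLx := LInf_nonneg ξ x
  have hLz := LInf_nonneg ξ z
  have h0 := norm_le_powBound_mul ξ x
  set K := powBound ξ
  have hA : ‖x‖ / (2 * K) ≤ |(x 0 : ℝ)| := by
    rw [div_le_iff₀ (by positivity)]
    linarith
  have hB : 2 * K * (‖x‖ * LInf ξ z + ‖z‖ * LInf ξ x) ≤ 4 * K * (‖x‖ * LInf ξ z) := by
    have : ‖z‖ * LInf ξ x ≤ ‖x‖ * LInf ξ z := mul_le_mul hnorm hL hLx (norm_nonneg _)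
    nlinarith
  have hAB : (4 * K * (‖x‖ * LInf ξ z)) ^ 2 < ‖x‖ / (2 * K) := by
    rw [lt_div_iff₀ (by positivity)]
    nlinarith
  have hd : x 0 * x 2 = x 1 ^ 2 := by
    rw [det_symMat] at hx
    linarith
  have hx0 : x 0 ≠ 0 := by
    intro h
    rw [h] at hA
    have : 0 < ‖x‖ / (2 * K) := by positivity
    simp at hA
    linarith
  -- As x₀x₂ = x₁², the square of this minor is divisible by x₀, whose size is about ‖x‖, whereas
  -- the square is ≪ ‖x‖²L(z)², which is smaller.
  have hp : x 0 * z 1 - x 1 * z 0 = 0 := by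
    refine int_eq_zero_of_mul_eq_sq (a := x 0) (b := x 0 * z 1 ^ 2 - 2 * x 1 * z 0 * z 1 +
      x 2 * z 0 ^ 2) ?_ hA (B := 4 * K * (‖x‖ * LInf ξ z)) ?_ hAB
    · linear_combination z 0 ^ 2 * hd
    · push_cast
      exact (abs_symMat_mul_J_mul_le ξ x z (.inl ⟨rfl, rfl⟩) (.inl ⟨rfl, rfl⟩)).trans hB
  have hq : x 0 * z 2 - x 1 * z 1 = 0 := by
    refine int_eq_zero_of_mul_eq_sq (a := x 0) (b := x 0 * z 2 ^ 2 - 2 * x 1 * z 1 * z 2 +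
      x 2 * z 1 ^ 2) ?_ hA (B := 4 * K * (‖x‖ * LInf ξ z)) ?_ hAB
    · linear_combination z 1 ^ 2 * hd
    · push_cast
      exact (abs_symMat_mul_J_mul_le ξ x z (.inl ⟨rfl, rfl⟩) (.inr ⟨rfl, rfl⟩)).trans hB
  rw [cross_apply]
  ext i
  fin_cases i
  · show z 1 * x 2 - z 2 * x 1 = 0
    refine (mul_eq_zero.1 ?_).resolve_left hx0
    linear_combination z 1 * hd - x 1 * hq
  · show z 2 * x 0 - z 0 * x 2 = 0
    refine (mul_eq_zero.1 ?_).resolve_left hx0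
    linear_combination x 0 * hq - z 0 * hd + x 1 * hp
  · show z 0 * x 1 - z 1 * x 0 = 0
    linarith

/-- Both n and u × v are normal to the plane of u and v, hence n is a multiple of u × v. -/
lemma crossProduct_dotProduct_eq_zero {n u v z : Fin 3 → ℤ} (huv : u ⨯₃ v ≠ 0)
    (hu : n ⬝ᵥ u = 0) (hv : n ⬝ᵥ v = 0) (hz : (u ⨯₃ v) ⬝ᵥ z = 0) : n ⬝ᵥ z = 0 := by
  have h : (u ⨯₃ v) ⨯₃ n = 0 := by
    simp only [dotProduct, Fin.sum_univ_three] at hu hv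
    ext i
    fin_cases i
    · simp [cross_apply]; linear_combination v 0 * hu - u 0 * hv
    · simp [cross_apply]; linear_combination v 1 * hu - u 1 * hv
    · simp [cross_apply]; linear_combination v 2 * hu - u 2 * hv
  obtain ⟨r, hr⟩ := exists_rat_mul_of_crossProduct_eq_zero huv h
  have hz' : ((u ⨯₃ v) 0 : ℚ) * z 0 + ((u ⨯₃ v) 1 : ℤ) * z 1 + ((u ⨯₃ v) 2 : ℤ) * z 2 = 0 := by
    simp only [dotProduct, Fin.sum_univ_three] at hz
    exact_mod_cast hz
  have : ((n ⬝ᵥ z : ℤ) : ℚ) = 0 := by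
    simp only [dotProduct, Fin.sum_univ_three]
    push_cast
    rw [hr 0, hr 1, hr 2]
    linear_combination r * hz'
  exact_mod_cast this

namespace IsMinimalSequence

variable {ξ lam : ℝ} {x : ℕ → Fin 3 → ℤ}

lemma norm_pos (h : IsMinimalSequence ξ x) (i : ℕ) : 0 < ‖x i‖ :=
  zero_lt_one.trans_le (one_le_norm (h.ne_zero i))

lemma tendsto_log_norm (h : IsMinimalSequence ξ x) :
    Tendsto (fun i => Real.log ‖x i‖) atTop atTop :=
  Real.tendsto_log_atTop.comp h.tendsto_norm

lemma eventually_LInf_lt (h : IsMinimalSequence ξ x) (hlam : 0 < lam)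
    (he : IsExponentOfApproximation ξ lam) {ε : ℝ} (hε : 0 < ε) :
    ∀ᶠ i in atTop, LInf ξ (x i) < ε := by
  obtain ⟨z, hz, hzε⟩ := he.exists_LInf_lt hlam hε
  filter_upwards [h.tendsto_norm.eventually_gt_atTop ‖z‖] with i hi
  by_contra hle
  have h1 := h.minimal i z hz (hzε.trans_le (not_lt.1 hle))
  linarith [h.norm_lt i]

/-- Since ‖x_{i+1}‖ L(x_i)² ≪ ‖x_{i+1}‖^{1-2λ} tends to 0, a zero determinant at x_{i+1} would make
it parallel to x_i. -/
lemma eventually_det_ne_zero (h : IsMinimalSequence ξ x) (hξ : IndepPowers ξ)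
    (hlam : 1 / 2 < lam) (he : IsExponentOfApproximation ξ lam) :
    ∀ᶠ i in atTop, (symMat (x i)).det ≠ 0 := by
  obtain ⟨C, hC⟩ := h.exists_log_LInf_le hξ (by linarith) he
  have hK := powBound_pos ξ
  have hK3 : 0 < 32 * powBound ξ ^ 3 := by positivity
  have h1 : Tendsto (fun i => (1 - 2 * lam) * Real.log ‖x (i + 1)‖) atTop atBot :=
    ((tendsto_add_atTop_iff_nat 1).2 h.tendsto_log_norm).const_mul_atTop_of_neg (by linarith)
  have h2 : ∀ᶠ i in atTop, (symMat (x (i + 1))).det ≠ 0 := by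
    filter_upwards [h1.eventually_lt_atBot (- Real.log (32 * powBound ξ ^ 3) - 2 * C),
      h.eventually_LInf_lt (by linarith) he (ε := 1 / 2) (by norm_num)] with i hi hi' h0
    have hLpos := hξ.LInf_pos (h.ne_zero i)
    refine h.crossProduct_ne_zero (Nat.lt_succ_self i)
      (crossProduct_eq_zero_of_det_symMat_eq_zero h0 ?_ (h.norm_lt i).le (h.LInf_lt i).le ?_
        (h.norm_pos _))
    · linarith [h.LInf_lt i, one_le_norm (h.ne_zero (i + 1))]
    · rw [← Real.log_neg_iff (by have := h.norm_pos (i + 1); positivity),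
        Real.log_mul hK3.ne' (by have := h.norm_pos (i + 1); positivity),
        Real.log_mul (h.norm_pos _).ne' (by positivity), Real.log_pow]
      have := hC i
      push_cast
      linarith
  rwa [← eventually_map (m := fun i => i + 1) (P := fun i => (symMat (x i)).det ≠ 0),
    map_add_atTop_eq_nat] at h2

/-- Minimal points approach the direction (1, ξ, ξ²), so a normal n to all late ones would give a
rational linear relation among 1, ξ, ξ². -/
lemma exists_dotProduct_ne_zero (h : IsMinimalSequence ξ x) (hξ : IndepPowers ξ) (hlam : 0 < lam)
    (he : IsExponentOfApproximation ξ lam) {n : Fin 3 → ℤ} (hn : n ≠ 0) (i : ℕ) :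
    ∃ j, i ≤ j ∧ n ⬝ᵥ x j ≠ 0 := by
  by_contra! hall
  refine hn (hξ n ?_)
  set s : ℝ := (n 0 : ℝ) + n 1 * ξ + n 2 * ξ ^ 2
  have key : ∀ ε : ℝ, 0 < ε → ε < 1 → |s| ≤ (|(n 1 : ℝ)| + |(n 2 : ℝ)|) * ε := by
    intro ε hε hε1
    obtain ⟨j, hj, hij⟩ := ((h.eventually_LInf_lt hlam he hε).and
      (eventually_ge_atTop i)).exists
    obtain ⟨a, b, ha, hb, h1, h2⟩ := exists_deviation ξ (x j)
    have h3 := hall j hij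
    simp only [dotProduct, Fin.sum_univ_three] at h3
    have h4 : (n 0 : ℝ) * x j 0 + n 1 * x j 1 + n 2 * x j 2 = 0 := by exact_mod_cast h3
    have hx0 : x j 0 ≠ 0 := by
      intro h0
      have h5 := norm_le_powBound_mul ξ (x j)
      rw [h0] at h5
      simp at h5
      linarith [one_le_norm (h.ne_zero j)]
    have hx1 : (1 : ℝ) ≤ |(x j 0 : ℝ)| := by exact_mod_cast Int.one_le_abs hx0
    have h5 : s * x j 0 = -(n 1 * a + n 2 * b) := by
      rw [h1, h2] at h4
      simp only [s]
      linarith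
    calc |s| ≤ |s| * |(x j 0 : ℝ)| := le_mul_of_one_le_right (abs_nonneg _) hx1
      _ = |(n 1 * a + n 2 * b : ℝ)| := by rw [← abs_mul, h5, abs_neg]
      _ ≤ |(n 1 : ℝ)| * ε + |(n 2 : ℝ)| * ε := abs_add_le_add
          (abs_mul_le_mul' le_rfl (ha.trans hj.le)) (abs_mul_le_mul' le_rfl (hb.trans hj.le))
      _ = _ := by ring
  by_contra hs
  have hs' : 0 < |s| := abs_pos.2 hs
  set T := |(n 1 : ℝ)| + |(n 2 : ℝ)|
  have hT : 0 ≤ T := by positivity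
  -- This ε is below 1 and makes Tε smaller than |s|.
  have h1 := key (|s| / (2 * T + 2 * |s| + 1)) (by positivity)
    (by rw [div_lt_one (by positivity)]; linarith)
  rw [← mul_div_assoc, le_div_iff₀ (by positivity)] at h1
  nlinarith

end IsMinimalSequence

/-! ### Changes of plane along the minimal points. -/

/-- `j` is the last index such that `x_i, …, x_j` lie in the plane of `x_i` and `x_{i+1}`. -/
structure IsNextIndex (x : ℕ → Fin 3 → ℤ) (i j : ℕ) : Prop where
  lt : i < j
  mem : ∀ m, i ≤ m → m ≤ j → (x i ⨯₃ x (i + 1)) ⬝ᵥ x m = 0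
  not_mem : (x i ⨯₃ x (i + 1)) ⬝ᵥ x (j + 1) ≠ 0

namespace IsMinimalSequence

variable {ξ lam : ℝ} {x : ℕ → Fin 3 → ℤ}

lemma exists_isNextIndex (h : IsMinimalSequence ξ x) (hξ : IndepPowers ξ) (hlam : 0 < lam)
    (he : IsExponentOfApproximation ξ lam) (i : ℕ) : ∃ j, IsNextIndex x i j := by
  classical
  have hex := h.exists_dotProduct_ne_zero hξ hlam he (h.crossProduct_ne_zero (Nat.lt_succ_self i)) i
  have hs := Nat.find_spec hex
  have hmin : ∀ m, i ≤ m → m < Nat.find hex → (x i ⨯₃ x (i + 1)) ⬝ᵥ x m = 0 := fun m hm hlt => by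
    have := Nat.find_min hex hlt
    push Not at this
    exact this hm
  set t := Nat.find hex
  have h0 : t ≠ i := by
    intro e
    rw [e] at hs
    exact hs.2 (by simp [cross_apply, dotProduct, Fin.sum_univ_three]; ring)
  have h1 : t ≠ i + 1 := by
    intro e
    rw [e] at hs
    exact hs.2 (by simp [cross_apply, dotProduct, Fin.sum_univ_three]; ring)
  have h2 : t = (t - 1) + 1 := by omega
  exact ⟨t - 1, by omega, fun m hm hm' => hmin m hm (by omega), h2 ▸ hs.2⟩

lemma det₃_ne_zero (h : IsMinimalSequence ξ x) {i j : ℕ} (hij : IsNextIndex x i j) :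
    (Matrix.of ![x (j - 1), x j, x (j + 1)]).det ≠ 0 := by
  have hlt := hij.lt
  rw [det_eq_crossProduct_dotProduct]
  intro h0
  exact hij.not_mem (crossProduct_dotProduct_eq_zero (h.crossProduct_ne_zero (by omega))
    (hij.mem _ (by omega) (by omega)) (hij.mem _ (by omega) le_rfl) h0)

/-- The two successive planes meet in the line of x_j, and they are distinct because x_{j+1} has
left the first one. -/
lemma exists_crossProduct_eq_smul (h : IsMinimalSequence ξ x) {i j : ℕ} (hij : IsNextIndex x i j) :
    ∃ t : ℤ, t ≠ 0 ∧ (x i ⨯₃ x (i + 1)) ⨯₃ (x j ⨯₃ x (j + 1)) = t • x j := by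
  have hlt := hij.lt
  have hm := hij.mem j (by omega) le_rfl
  obtain ⟨t, ht⟩ := (h.primitive j).exists_eq_smul
    (y := (x i ⨯₃ x (i + 1)) ⨯₃ (x j ⨯₃ x (j + 1))) (by
      generalize x i ⨯₃ x (i + 1) = n at hm
      simp only [dotProduct, Fin.sum_univ_three] at hm
      ext k
      fin_cases k
      · simp [cross_apply]
        linear_combination (-(x j 1 * x (j + 1) 2 - x j 2 * x (j + 1) 1)) * hm
      · simp [cross_apply]
        linear_combination (-(x j 2 * x (j + 1) 0 - x j 0 * x (j + 1) 2)) * hm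
      · simp [cross_apply]
        linear_combination (-(x j 0 * x (j + 1) 1 - x j 1 * x (j + 1) 0)) * hm)
  refine ⟨t, ?_, ht⟩
  rintro rfl
  rw [zero_smul, ← neg_eq_zero, cross_anticomm] at ht
  obtain ⟨r, hr⟩ := exists_rat_mul_of_crossProduct_eq_zero
    (h.crossProduct_ne_zero (Nat.lt_succ_self j)) ht
  refine hij.not_mem ?_
  have : (((x i ⨯₃ x (i + 1)) ⬝ᵥ x (j + 1) : ℤ) : ℚ) = 0 := by
    simp only [dotProduct, Fin.sum_univ_three]
    push_cast
    rw [hr 0, hr 1, hr 2]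
    simp [cross_apply]
    ring
  exact_mod_cast this

lemma norm_le_of_isNextIndex (h : IsMinimalSequence ξ x) {i j : ℕ} (hij : IsNextIndex x i j) :
    ‖x j‖ ≤ 2 * (‖x i ⨯₃ x (i + 1)‖ * ‖x j ⨯₃ x (j + 1)‖) := by
  obtain ⟨t, ht0, ht⟩ := h.exists_crossProduct_eq_smul hij
  have h1 : (1 : ℝ) ≤ |(t : ℝ)| := by exact_mod_cast Int.one_le_abs ht0
  have h2 : ‖x j‖ ≤ ‖t • x j‖ := by
    rw [norm_int_smul]
    exact le_mul_of_one_le_left (norm_nonneg _) h1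
  rw [← ht] at h2
  refine h2.trans (norm_le_of_abs_apply_le fun k => ?_)
  generalize x i ⨯₃ x (i + 1) = u
  generalize x j ⨯₃ x (j + 1) = v
  have key : ∀ a b : Fin 3, |(u a * v b - u b * v a : ℝ)| ≤ 2 * (‖u‖ * ‖v‖) := fun a b => by
    refine (abs_sub_le_add (abs_mul_le_mul' (abs_apply_le_norm u a) (abs_apply_le_norm v b))
      (abs_mul_le_mul' (abs_apply_le_norm u b) (abs_apply_le_norm v a))).trans ?_
    linarith
  rw [cross_apply]
  fin_cases k
  · simpa using key 1 2
  · simpa using key 2 0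
  · simpa using key 0 1

/-- If x_p lay in the plane of x_i and x_j, it would lie in both successive planes, hence on the
line of x_j. -/
lemma det₃_ne_zero_of_isNextIndex (h : IsMinimalSequence ξ x) {i j p : ℕ}
    (hij : IsNextIndex x i j) (hjp : IsNextIndex x j p) :
    (Matrix.of ![x i, x j, x p]).det ≠ 0 := by
  have h1 := hij.lt
  have h2 := hjp.lt
  rw [det_eq_crossProduct_dotProduct]
  intro h0
  have hi := crossProduct_dotProduct_eq_zero (h.crossProduct_ne_zero h1)
    (hij.mem i le_rfl h1.le) (hij.mem j h1.le le_rfl) h0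
  have hj := hjp.mem p h2.le le_rfl
  obtain ⟨t, ht0, ht⟩ := h.exists_crossProduct_eq_smul hij
  have h3 : t • (x j ⨯₃ x p) = 0 := by
    have : t • (x j ⨯₃ x p) = (t • x j) ⨯₃ x p := by rw [map_smul]; rfl
    rw [this, ← ht]
    generalize x i ⨯₃ x (i + 1) = u at hi
    generalize x j ⨯₃ x (j + 1) = v at hj
    simp only [dotProduct, Fin.sum_univ_three] at hi hj
    ext k
    fin_cases k
    · simp [cross_apply]; linear_combination v 0 * hi - u 0 * hj
    · simp [cross_apply]; linear_combination v 1 * hi - u 1 * hj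
    · simp [cross_apply]; linear_combination v 2 * hi - u 2 * hj
  exact (smul_ne_zero ht0 (h.crossProduct_ne_zero h2)) h3

end IsMinimalSequence

/-! ### Existence of approximation sequences. -/

lemma dominated_of_log_le {u v : ℕ → ℝ} (C : ℝ) (hu : ∀ k, 1 ≤ k → 0 < u k)
    (hv : ∀ k, 1 ≤ k → 0 < v k) (h : ∀ k, 1 ≤ k → Real.log (u k) ≤ Real.log (v k) + C) :
    Dominated u v := by
  refine ⟨Real.exp C, Real.exp_pos C, fun k hk => ?_⟩
  rw [← Real.log_le_log_iff (hu k hk) (mul_pos (Real.exp_pos C) (hv k hk)),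
    Real.log_mul (Real.exp_pos C).ne' (hv k hk).ne', Real.log_exp]
  linarith [h k hk]

namespace IsMinimalSequence

variable {ξ lam : ℝ} {x : ℕ → Fin 3 → ℤ}

lemma log_det_le (h : IsMinimalSequence ξ x) (hξ : IndepPowers ξ) {i : ℕ}
    (hd : (symMat (x i)).det ≠ 0) :
    Real.log ((|(symMat (x i)).det| : ℤ) : ℝ) ≤
      Real.log (5 * powBound ξ) + Real.log ‖x i‖ + Real.log (LInf ξ (x i)) := by
  have h1 : (0 : ℝ) < ((|(symMat (x i)).det| : ℤ) : ℝ) := by exact_mod_cast abs_pos.2 hd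
  have hK := powBound_pos ξ
  have hX := h.norm_pos i
  have hL := hξ.LInf_pos (h.ne_zero i)
  refine (Real.log_le_log h1 (abs_det_symMat_le ξ (x i))).trans (le_of_eq ?_)
  rw [Real.log_mul (by positivity) (by positivity), Real.log_mul hX.ne' hL.ne']
  ring

lemma log_det₃_le (h : IsMinimalSequence ξ x) (hξ : IndepPowers ξ) {i j p : ℕ} (hij : i < j)
    (hjp : j < p) (hd : (Matrix.of ![x i, x j, x p]).det ≠ 0) :
    Real.log ((|(Matrix.of ![x i, x j, x p]).det| : ℤ) : ℝ) ≤
      Real.log 6 + Real.log ‖x p‖ + Real.log (LInf ξ (x i)) + Real.log (LInf ξ (x j)) := by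
  have h1 : (0 : ℝ) < ((|(Matrix.of ![x i, x j, x p]).det| : ℤ) : ℝ) := by
    exact_mod_cast abs_pos.2 hd
  have hX := h.norm_pos p
  have hi := hξ.LInf_pos (h.ne_zero i)
  have hj := hξ.LInf_pos (h.ne_zero j)
  have hp := hξ.LInf_pos (h.ne_zero p)
  have n1 : ‖x i‖ ≤ ‖x p‖ := h.norm_strictMono.monotone (hij.trans hjp).le
  have n2 : ‖x j‖ ≤ ‖x p‖ := h.norm_strictMono.monotone hjp.le
  have m1 : LInf ξ (x j) ≤ LInf ξ (x i) := h.LInf_strictAnti.antitone hij.le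
  have m2 : LInf ξ (x p) ≤ LInf ξ (x j) := h.LInf_strictAnti.antitone hjp.le
  have h2 : 2 * (‖x i‖ * LInf ξ (x j) * LInf ξ (x p) + ‖x j‖ * LInf ξ (x i) * LInf ξ (x p) +
        ‖x p‖ * LInf ξ (x i) * LInf ξ (x j)) ≤ 6 * (‖x p‖ * LInf ξ (x i) * LInf ξ (x j)) := by
    have a1 : ‖x i‖ * LInf ξ (x j) * LInf ξ (x p) ≤ ‖x p‖ * LInf ξ (x i) * LInf ξ (x j) := by
      gcongr
    have a2 : ‖x j‖ * LInf ξ (x i) * LInf ξ (x p) ≤ ‖x p‖ * LInf ξ (x i) * LInf ξ (x j) := by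
      gcongr
    linarith
  refine (Real.log_le_log h1 ((abs_det₃_le ξ _ _ _).trans h2)).trans (le_of_eq ?_)
  rw [Real.log_mul (by norm_num) (by positivity), Real.log_mul (by positivity) hj.ne',
    Real.log_mul hX.ne' hi.ne']
  ring

lemma log_norm_crossProduct_le (h : IsMinimalSequence ξ x) (hξ : IndepPowers ξ) (i : ℕ) :
    Real.log ‖x i ⨯₃ x (i + 1)‖ ≤
      Real.log (8 * powBound ξ) + Real.log ‖x (i + 1)‖ + Real.log (LInf ξ (x i)) := by
  have h1 : 0 < ‖x i ⨯₃ x (i + 1)‖ := zero_lt_one.trans_le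
    (one_le_norm (h.crossProduct_ne_zero (Nat.lt_succ_self i)))
  have hK := powBound_pos ξ
  have hX := h.norm_pos (i + 1)
  have hL := hξ.LInf_pos (h.ne_zero i)
  have h2 : ‖x i ⨯₃ x (i + 1)‖ ≤ 8 * powBound ξ * (‖x (i + 1)‖ * LInf ξ (x i)) := by
    refine (norm_crossProduct_le ξ _ _).trans ?_
    have : ‖x i‖ * LInf ξ (x (i + 1)) ≤ ‖x (i + 1)‖ * LInf ξ (x i) :=
      mul_le_mul (h.norm_lt i).le (h.LInf_lt i).le (LInf_nonneg _ _) (norm_nonneg _)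
    nlinarith
  refine (Real.log_le_log h1 h2).trans (le_of_eq ?_)
  rw [Real.log_mul (by positivity) (by positivity), Real.log_mul hX.ne' hL.ne']
  ring

lemma exists_isNextIndex_seq (h : IsMinimalSequence ξ x) (hξ : IndepPowers ξ) (hlam : 0 < lam)
    (he : IsExponentOfApproximation ξ lam) (i₀ : ℕ) :
    ∃ s : ℕ → ℕ, (∀ k, i₀ ≤ s k) ∧ ∀ k, IsNextIndex x (s k) (s (k + 1)) := by
  choose f hf using h.exists_isNextIndex hξ hlam he
  refine ⟨fun k => Nat.rec i₀ (fun _ i => f i) k, fun k => ?_, fun k => hf _⟩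
  induction k with
  | zero => exact le_rfl
  | succ k ih => exact ih.trans (hf _).lt.le

end IsMinimalSequence

/-- The logarithmic growth conditions that make a sequence an approximation sequence. -/
lemma IsApproximationSequence.of_log {ξ lam C : ℝ} {y : ℕ → Fin 3 → ℤ} (hlam : 1 / 2 < lam)
    (hlam1 : lam < 1) (hξ : IndepPowers ξ)
    (prim : ∀ k, IsPrimitivePoint (y k))
    (hunb : Tendsto (fun k => ‖y k‖) atTop atTop)
    (hne : ∀ k, y k ≠ 0)
    (hdet : ∀ k, 1 ≤ k → (symMat (y k)).det ≠ 0)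
    (hdet₃ : ∀ k, 1 ≤ k → (Matrix.of ![y k, y (k + 1), y (k + 2)]).det ≠ 0)
    (hA : ∀ k, 1 ≤ k → thetaOf lam * Real.log ‖y k‖ ≤ Real.log ‖y (k + 1)‖ + C)
    (hB : ∀ k, 1 ≤ k →
      Real.log ‖y (k + 1)‖ ≤ 1 / (thetaOf lam - 1) * Real.log ‖y k‖ + C)
    (hL : ∀ k, 1 ≤ k → Real.log (LInf ξ (y k)) ≤
      -(thetaOf lam ^ 2 / (thetaOf lam + 1)) * Real.log ‖y k‖ + C)
    (hlogdet : ∀ k, 1 ≤ k → Real.log ((|(symMat (y k)).det| : ℤ) : ℝ) ≤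
      Real.log ‖y k‖ + Real.log (LInf ξ (y k)) + C)
    (hlogdet₃ : ∀ k, 1 ≤ k →
      Real.log ((|(Matrix.of ![y k, y (k + 1), y (k + 2)]).det| : ℤ) : ℝ) ≤
      Real.log ‖y (k + 2)‖ + Real.log (LInf ξ (y k)) + Real.log (LInf ξ (y (k + 1))) + C) :
    IsApproximationSequence ξ lam y := by
  have hθ : 1 < thetaOf lam := by
    unfold thetaOf
    rw [lt_div_iff₀ (by linarith)]
    linarith
  set θ := thetaOf lam
  have hY : ∀ k, 0 < ‖y k‖ := fun k => zero_lt_one.trans_le (one_le_norm (hne k))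
  have hLp : ∀ k, 0 < LInf ξ (y k) := fun k => hξ.LInf_pos (hne k)
  have hd1 : ∀ k, 1 ≤ k → 1 ≤ |(symMat (y k)).det| := fun k hk => Int.one_le_abs (hdet k hk)
  have hd3 : ∀ k, 1 ≤ k → 1 ≤ |(Matrix.of ![y k, y (k + 1), y (k + 2)]).det| :=
    fun k hk => Int.one_le_abs (hdet₃ k hk)
  have hd1' : ∀ k, 1 ≤ k → (1 : ℝ) ≤ ((|(symMat (y k)).det| : ℤ) : ℝ) :=
    fun k hk => by exact_mod_cast hd1 k hk
  have hd3' : ∀ k, 1 ≤ k →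
      (1 : ℝ) ≤ ((|(Matrix.of ![y k, y (k + 1), y (k + 2)]).det| : ℤ) : ℝ) :=
    fun k hk => by exact_mod_cast hd3 k hk
  refine ⟨fun k _ => prim k, ?_, ?_, ?_, ?_, ?_, hd1, ?_, hd3, ?_⟩
  · intro B
    obtain ⟨k, hk, hk1⟩ := ((hunb.eventually_gt_atTop B).and (eventually_ge_atTop 1)).exists
    exact ⟨k, hk1, hk⟩
  · refine dominated_of_log_le C (fun k _ => Real.rpow_pos_of_pos (hY k) _) (fun k _ => hY _)
      fun k hk => ?_
    rw [Real.log_rpow (hY k)]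
    exact hA k hk
  · refine dominated_of_log_le C (fun k _ => hY _) (fun k _ => Real.rpow_pos_of_pos (hY k) _)
      fun k hk => ?_
    rw [Real.log_rpow (hY k)]
    exact hB k hk
  · refine dominated_of_log_le C (fun k _ => Real.rpow_pos_of_pos (hY k) _) (fun k _ => hLp _)
      fun k hk => ?_
    rw [Real.log_rpow (hY k)]
    -- The lower bound for L comes from 1 ≤ |det(y_k)| ≪ Y_k L(y_k).
    have := hlogdet k hk
    have := Real.log_nonneg (hd1' k hk)
    linarith
  · refine dominated_of_log_le C (fun k _ => hLp _) (fun k _ => Real.rpow_pos_of_pos (hY k) _)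
      fun k hk => ?_
    rw [Real.log_rpow (hY k)]
    exact hL k hk
  · refine dominated_of_log_le (2 * C) (fun k hk => zero_lt_one.trans_le (hd1' k hk))
      (fun k _ => Real.rpow_pos_of_pos (hY k) _) fun k hk => ?_
    rw [Real.log_rpow (hY k)]
    have := hlogdet k hk
    have := hL k hk
    linarith
  · set ρ := 1 / (θ - 1) with hρ
    set a := θ ^ 2 / (θ + 1) with ha
    have hρ0 : 0 ≤ ρ := by rw [hρ]; exact one_div_nonneg.2 (by linarith)
    have ha0 : 0 ≤ a := by positivity
    have haθ : a * (1 + θ) = θ ^ 2 := by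
      rw [ha, add_comm 1 θ]
      exact div_mul_cancel₀ _ (by linarith)
    refine dominated_of_log_le (3 * C + ρ * C + C + a * C)
      (fun k hk => zero_lt_one.trans_le (hd3' k hk))
      (fun k _ => Real.rpow_pos_of_pos (hY k) _) fun k hk => ?_
    rw [Real.log_rpow (hY k), show 1 / (θ - 1) ^ 2 = ρ ^ 2 by rw [hρ, div_pow, one_pow], ← haθ]
    have h0 := hlogdet₃ k hk
    have h1 := hL k hk
    have h2 := hL (k + 1) (by omega)
    have h3 := hB (k + 1) (by omega)
    have h4 := mul_le_mul_of_nonneg_left (hB k hk) hρ0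
    have h5 := mul_le_mul_of_nonneg_left (hA k hk) ha0
    rw [add_assoc] at h3
    norm_num at h3
    linarith

theorem exists_isApproximationSequence {ξ lam : ℝ} (hξ : IndepPowers ξ) (hlam : 1 / 2 < lam)
    (hlam1 : lam < 1) (he : IsExponentOfApproximation ξ lam) :
    ∃ y, IsApproximationSequence ξ lam y := by
  have hlam0 : 0 < lam := by linarith
  obtain ⟨x, hx⟩ := exists_isMinimalSequence hξ fun ε hε => he.exists_LInf_lt hlam0 hε
  obtain ⟨i₀, hi₀⟩ := eventually_atTop.1 (hx.eventually_det_ne_zero hξ hlam he)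
  obtain ⟨C₀, hC₀⟩ := hx.exists_log_LInf_le hξ hlam0 he
  obtain ⟨s, hs, hnext⟩ := hx.exists_isNextIndex_seq hξ hlam0 he (i₀ + 1)
  have hsmono : StrictMono s := strictMono_nat_of_lt_succ fun k => (hnext k).lt
  have hθ : 1 < thetaOf lam := by
    unfold thetaOf
    rw [lt_div_iff₀ (by linarith)]
    linarith
  have hθlam : thetaOf lam * (1 - lam) = lam := div_mul_cancel₀ _ (by linarith)
  set θ := thetaOf lam with hθdef
  set l := fun i => Real.log ‖x i‖ with hl
  set m := fun i => Real.log (LInf ξ (x i)) with hm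
  have hlmono : Monotone l := fun i j hij =>
    Real.log_le_log (hx.norm_pos i) (hx.norm_strictMono.monotone hij)
  obtain ⟨c, hc0, c1, c2, c3, c4, c5⟩ : ∃ c : ℝ, 0 ≤ c ∧ C₀ ≤ c ∧ Real.log (5 * powBound ξ) ≤ c ∧
      Real.log 6 ≤ c ∧ Real.log (8 * powBound ξ) ≤ c ∧ Real.log 2 ≤ c :=
    ⟨max 0 (max C₀ (max (Real.log (5 * powBound ξ)) (max (Real.log 6)
      (max (Real.log (8 * powBound ξ)) (Real.log 2))))), by simp⟩
  have hdet : ∀ i, i₀ ≤ i → (symMat (x i)).det ≠ 0 := hi₀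
  have e1 : ∀ i, m i ≤ -lam * l (i + 1) + c := fun i => (hC₀ i).trans (by linarith)
  have e2 : ∀ i, i₀ ≤ i → Real.log ((|(symMat (x i)).det| : ℤ) : ℝ) ≤ l i + m i + c :=
    fun i hi => (hx.log_det_le hξ (hdet i hi)).trans (by simp only [hl, hm]; linarith)
  have e2' : ∀ i, i₀ ≤ i → lam * l (i + 1) ≤ l i + 2 * c := by
    intro i hi
    have h1 : (1 : ℝ) ≤ ((|(symMat (x i)).det| : ℤ) : ℝ) := by
      exact_mod_cast Int.one_le_abs (hdet i hi)
    have := Real.log_nonneg h1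
    have := e2 i hi
    have := e1 i
    linarith
  -- With s = s_k and X_i = ‖x_i‖, independence of x_{s-1}, x_s, x_{s+1} gives 1 ≪ X_{s+1}
  -- L(x_{s-1}) L(x_s) ≪ X_{s+1}^{1-λ} X_s^{-λ}. The index s_0 is excluded, since the plane need not
  -- change there.
  have e3 : ∀ k, 1 ≤ k → θ * l (s k) ≤ l (s k + 1) + 3 * c / (1 - lam) := by
    intro k hk
    obtain ⟨k, rfl⟩ : ∃ n, k = n + 1 := ⟨k - 1, by omega⟩
    have hpos : 1 ≤ s (k + 1) := by have := hs (k + 1); omega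
    have h0 := hx.det₃_ne_zero (hnext k)
    have h1 : (1 : ℝ) ≤ ((|(Matrix.of ![x (s (k + 1) - 1), x (s (k + 1)),
        x (s (k + 1) + 1)]).det| : ℤ) : ℝ) := by
      exact_mod_cast Int.one_le_abs h0
    have h2 := Real.log_nonneg h1
    have h3 := hx.log_det₃_le hξ (by omega) (by omega) h0
    have h4 := e1 (s (k + 1))
    have h5 := e1 (s (k + 1) - 1)
    rw [Nat.sub_add_cancel hpos] at h5
    have h6 : 0 ≤ (1 - lam) * (l (s (k + 1) + 1) - θ * l (s (k + 1))) + 3 * c := by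
      have : (1 - lam) * (l (s (k + 1) + 1) - θ * l (s (k + 1))) =
        (1 - lam) * l (s (k + 1) + 1) - lam * l (s (k + 1)) := by
          linear_combination (-l (s (k + 1))) * hθlam
      rw [this]
      simp only [hl, hm] at h3 h4 h5 ⊢
      linarith
    have h7 : 3 * c / (1 - lam) * (1 - lam) = 3 * c := div_mul_cancel₀ _ (by linarith)
    by_contra hlt
    nlinarith
  -- The cross product is ≪ X_{i+1}^{1-λ}, and X_{i+1}^λ ≪ X_i because det(x_i) ≠ 0.
  have e4 : ∀ i, i₀ ≤ i → θ * Real.log ‖x i ⨯₃ x (i + 1)‖ ≤ l i + 2 * c + 2 * θ * c := by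
    intro i hi
    have h1 := hx.log_norm_crossProduct_le hξ i
    have h2 := e1 i
    have h3 : Real.log ‖x i ⨯₃ x (i + 1)‖ ≤ (1 - lam) * l (i + 1) + 2 * c := by
      simp only [hl, hm] at h2 ⊢
      linarith
    have h4 := mul_le_mul_of_nonneg_left h3 (by linarith : 0 ≤ θ)
    have h5 : θ * ((1 - lam) * l (i + 1) + 2 * c) = lam * l (i + 1) + 2 * θ * c := by
      rw [mul_add, ← mul_assoc, hθlam]; ring
    linarith [e2' i hi]
  -- Bounding x_{s_{k+1}} by the two plane normals gives X_{s_{k+1}}^θ ≪ X_{s_k} X_{s_{k+1}}.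
  have e5 : ∀ k, (θ - 1) * l (s (k + 1)) ≤ l (s k) + (4 * c + 5 * θ * c) := by
    intro k
    have h0 := hx.norm_le_of_isNextIndex (hnext k)
    have p1 : 0 < ‖x (s k) ⨯₃ x (s k + 1)‖ := zero_lt_one.trans_le
      (one_le_norm (hx.crossProduct_ne_zero (Nat.lt_succ_self _)))
    have p2 : 0 < ‖x (s (k + 1)) ⨯₃ x (s (k + 1) + 1)‖ := zero_lt_one.trans_le
      (one_le_norm (hx.crossProduct_ne_zero (Nat.lt_succ_self _)))
    have h1 := Real.log_le_log (hx.norm_pos _) h0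
    rw [Real.log_mul (by norm_num) (by positivity), Real.log_mul p1.ne' p2.ne'] at h1
    have h2 := e4 (s k) (by have := hs k; omega)
    have h3 := e4 (s (k + 1)) (by have := hs (k + 1); omega)
    have h4 := mul_le_mul_of_nonneg_left h1 (by linarith : 0 ≤ θ)
    have h5 := mul_le_mul_of_nonneg_left c5 (by linarith : 0 ≤ θ)
    simp only [hl] at h2 h3 ⊢
    linarith
  set ρ := 1 / (θ - 1) with hρ
  have hρ0 : 0 ≤ ρ := one_div_nonneg.2 (by linarith)
  have hρθ : ρ * (θ - 1) = 1 := one_div_mul_cancel (by linarith)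
  have ha : θ ^ 2 / (θ + 1) = lam * θ := by
    rw [div_eq_iff (by linarith)]
    linear_combination θ * hθlam
  set A := 3 * c / (1 - lam) with hA
  have hA0 : 0 ≤ A := div_nonneg (by positivity) (by linarith)
  set B := ρ * (4 * c + 5 * θ * c) with hB
  have hB0 : 0 ≤ B := by
    have : 0 < θ := by linarith
    positivity
  have f1 : ∀ k, 1 ≤ k → Real.log (LInf ξ (x (s k))) ≤ -(lam * θ) * l (s k) + (lam * A + c) := by
    intro k hk
    have h1 := e1 (s k)
    have h2 := mul_le_mul_of_nonneg_left (e3 k hk) hlam0.le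
    simp only [hm] at h1
    linarith
  have hlA : 0 ≤ lam * A := by positivity
  refine ⟨fun k => x (s k), .of_log (C := A + B + lam * A + c) hlam hlam1 hξ
    (fun k => hx.primitive _)
    (hx.tendsto_norm.comp hsmono.tendsto_atTop) (fun k => hx.ne_zero _)
    (fun k _ => hdet _ (by have := hs k; omega))
    (fun k _ => hx.det₃_ne_zero_of_isNextIndex (hnext k) (hnext (k + 1)))
    (fun k hk => ?_) (fun k hk => ?_) (fun k hk => ?_) (fun k hk => ?_) (fun k hk => ?_)⟩
  · have h1 := e3 k hk
    have h2 := hlmono (Nat.succ_le_of_lt (hnext k).lt)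
    simp only [hl, Nat.succ_eq_add_one] at h1 h2
    linarith
  · have h1 := mul_le_mul_of_nonneg_left (e5 k) hρ0
    rw [← mul_assoc, hρθ, one_mul, mul_add] at h1
    simp only [hl] at h1
    linarith
  · rw [← hθdef, ha]
    have := f1 k hk
    simp only [hl] at this
    linarith
  · have := e2 (s k) (by have := hs k; omega)
    simp only [hl, hm] at this
    linarith
  · have := hx.log_det₃_le hξ (hnext k).lt (hnext (k + 1)).lt
      (hx.det₃_ne_zero_of_isNextIndex (hnext k) (hnext (k + 1)))
    simp only [add_assoc, Nat.reduceAdd] at this ⊢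
    linarith

end

/-! ### Conclusion. -/

theorem mainTheorem7 :
    ∃ lam₂ : ℝ, 0.61455261 ≤ lam₂ ∧ lam₂ < 0.61455262 ∧
      ∀ ξ lam : ℝ,
        2 < Module.rank ℚ (IntermediateField.adjoin ℚ ({ξ} : Set ℝ)) →
        lam₂ < lam → lam ≤ 1 / Real.goldenRatio →
        IsExponentOfApproximation ξ lam →
        (∃ y : ℕ → Fin 3 → ℤ, IsApproximationSequence ξ lam y) ∧
        ∀ y : ℕ → Fin 3 → ℤ, IsApproximationSequence ξ lam y →
          (∃ k₀ : ℕ, 3 ≤ k₀ ∧ ∀ k : ℕ, k₀ ≤ k →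
            IsNonzeroRationalMultiple (symMat (y (k + 1)))
              (bracket (y k) (y k) (y (k - 2)))) ∧
          (∃ M : Matrix (Fin 2) (Fin 2) ℤ, ¬ M.IsSymm ∧ M.det ≠ 0 ∧
            ∃ k₀ : ℕ, 3 ≤ k₀ ∧ ∀ k : ℕ, k₀ ≤ k →
              IsNonzeroRationalMultiple (symMat (y (k + 1)))
                (symMat (y k) * alternating M k * symMat (y (k - 1)))) := by
  -- The rounded exponents leave enough slack for the left endpoint of the admissible interval to
  -- serve as threshold.
  refine ⟨0.61455261, le_rfl, by norm_num, fun ξ lam hrank hlam hle he => ?_⟩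
  have hlt : lam < 0.619 := hle.trans_lt one_div_goldenRatio_lt
  refine ⟨exists_isApproximationSequence (indepPowers_of_two_lt_rank hrank) (by linarith)
    (by linarith) he, fun y hy => ?_⟩
  obtain ⟨k₀, hk₀, hbr⟩ := hy.exists_bracket hlam hlt
  obtain ⟨M, hM, hdet, hmul⟩ := exists_alternating_of_bracket hk₀ hy.det_ne_zero hy.det₃_ne_zero hbr
  exact ⟨⟨k₀, hk₀, hbr⟩, M, hM, hdet, k₀, hk₀, hmul⟩
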